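/- Let $(\bar M,\bar g,\bar J)$ be an indefinite Kähler manifold: $\bar g$ is a semi-Riemannian metric of constant index $q$, $0<q<\dim\bar M$, $\bar J$ is an almost complex structure with $\bar g(\bar JX,\bar JY)=\bar g(X,Y)$, and $\bar\nabla\bar J=0$ for the Levi-Civita connection $\bar\nabla$ of $\bar g$. Let $M$ be a lightlike (immersed) submanifold of $\bar M$: $\mathrm{Rad}(TM)=TM\cap TM^{\perp}$ has constant rank $r\ge 1$. Fix a screen distribution $S(TM)$ with $TM=S(TM)\perp \mathrm{Rad}(TM)$, a screen transversal bundle $S(TM^{\perp})$ with $TM^{\perp}=S(TM^{\perp})\perp \mathrm{Rad}(TM)$, and a lightlike transversal bundle $ltr(TM)$, that is, an isotropic complement of $\mathrm{Rad}(TM)$ in the orthogonal complement of $S(TM)\perp S(TM^{\perp})$ in $T\bar M|_M$. Put $tr(TM)=ltr(TM)\perp S(TM^\perp)$, so that $T\bar M|_M=TM\oplus tr(TM)$. For $X,Y\in\Gamma(TM)$ and $V\in\Gamma(tr(TM))$ let $\nabla_XY$ be the $TM$-part of $\bar\nabla_XY$ and $-A_VX$ the $TM$-part of $\bar\nabla_XV$.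 Suppose that $M$ is a screen transversal Cauchy–Riemann (STCR) lightlike submanifold: there are smooth subbundles $D_1,D_2$ of $\mathrm{Rad}(TM)$, $D_0,D'$ of $S(TM)$, $L_1$ of $ltr(TM)$ and $S$ of $S(TM^{\perp})$, with $D_0$ nondegenerate, such that $$\mathrm{Rad}(TM)=D_1\oplus D_2,\quad \bar JD_1\subset S(TM),\quad \bar JD_2\subset S(TM^\perp),$$ $$S(TM)=\{\bar JD_1\oplus D'\}\perp D_0,\quad \bar JD_0=D_0,\quad \bar JD'=L_1\perp S.$$ The distribution $D_0$ is called minimal if $\nabla_XX+\nabla_{\bar JX}\bar JX\in\Gamma(D_0)$ for every $X\in\Gamma(D_0)$. Then $D_0$ is minimal if and only if, for every $X\in\Gamma(D_0)$ and $N\in\Gamma(L_1)$, the section $A_N\bar JX+\bar JA_NX$ of $T\bar M|_M$ has no component in $D_0$, i.e. its $D_0$-component in the decomposition $T\bar M|_M=D_0\oplus\big(\{\bar JD_1\oplus D'\}\oplus \mathrm{Rad}(TM)\oplus tr(TM)\big)$ vanishes. -/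

import Mathlib

open Bundle Manifold ContDiff

noncomputable section

/-! ## Linear algebra of the transversal decomposition -/

/-- Let `T` be a subspace of a space with a nondegenerate symmetric form, `R = T ∩ Tᗮ` its radical,
`S` a complement of `R` in `T`, `C` a complement of `R` in `Tᗮ` and `L` a complement of `R` in
`(S + C)ᗮ`. Then `L + C` is a complement of `T`. -/
theorem isCompl_of_screens {V : Type*} [AddCommGroup V] [Module ℝ V] [FiniteDimensional ℝ V]
    (B : LinearMap.BilinForm ℝ V) (hB : B.Nondegenerate) (hs : B.IsSymm)
    (T S C L : Submodule ℝ V)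
    (hS : S ⊔ (T ⊓ B.orthogonal T) = T) (hS' : Disjoint S (T ⊓ B.orthogonal T))
    (hC : C ⊔ (T ⊓ B.orthogonal T) = B.orthogonal T) (hC' : Disjoint C (T ⊓ B.orthogonal T))
    (hL : L ⊔ (T ⊓ B.orthogonal T) = B.orthogonal (S ⊔ C))
    (hL' : Disjoint L (T ⊓ B.orthogonal T)) :
    IsCompl T (L ⊔ C) := by
  have hr : B.IsRefl := hs.isRefl
  have sy : ∀ x y, B x y = 0 → B y x = 0 := fun x y h => hr x y h
  set R := T ⊓ B.orthogonal T with hR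
  have hST : S ≤ T := hS ▸ le_sup_left
  have hRT : R ≤ T := inf_le_left
  have hRP : R ≤ B.orthogonal T := inf_le_right
  have hCP : C ≤ B.orthogonal T := hC ▸ le_sup_left
  have hSC : ∀ s ∈ S, ∀ c ∈ C, B s c = 0 := fun s h1 c h2 => hCP h2 s (hST h1)
  have hPP : B.orthogonal (B.orthogonal T) = T :=
    LinearMap.BilinForm.orthogonal_orthogonal hB hr T
  have hSCd : ∀ x ∈ S, x ∈ B.orthogonal T → x = 0 := fun x h1 h2 =>
    (Submodule.disjoint_def.1 hS') x h1 ⟨hST h1, h2⟩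
  have hW : Disjoint (S ⊔ C) (B.orthogonal (S ⊔ C)) := by
    rw [Submodule.disjoint_def]
    intro x hx hx'
    obtain ⟨s, h1, c, h2, rfl⟩ := Submodule.mem_sup.1 hx
    have hs0 : s = 0 := by
      refine hSCd s h1 ?_
      intro t ht
      rw [← hS] at ht
      obtain ⟨s', hs', r, hr', rfl⟩ := Submodule.mem_sup.1 ht
      have e1 := hx' s' (Submodule.mem_sup_left hs')
      have e2 := hSC s' hs' c h2
      have e3 := sy _ _ (hRP hr' s (hST h1))
      simp only [map_add, LinearMap.add_apply] at *
      linarith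
    have hc0 : c = 0 := by
      refine (Submodule.disjoint_def.1 hC') c h2 ⟨?_, hCP h2⟩
      rw [← hPP]
      intro t ht
      rw [← hC] at ht
      obtain ⟨c', hc', r, hr', rfl⟩ := Submodule.mem_sup.1 ht
      have e1 := hx' c' (Submodule.mem_sup_right hc')
      have e2 := sy _ _ (hSC s h1 c' hc')
      have e3 := hCP h2 r (hRT hr')
      simp only [map_add, LinearMap.add_apply] at *
      linarith
    simp [hs0, hc0]
  have hWc := (LinearMap.BilinForm.isCompl_orthogonal_iff_disjoint hr).2 hW
  constructor
  · rw [Submodule.disjoint_def]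
    intro x hx hx'
    rw [← hS] at hx
    obtain ⟨s, h1, r, h2, rfl⟩ := Submodule.mem_sup.1 hx
    obtain ⟨l, h3, c, h4, e⟩ := Submodule.mem_sup.1 hx'
    have hrW : r ∈ B.orthogonal (S ⊔ C) := hL ▸ Submodule.mem_sup_right h2
    have hlW : l ∈ B.orthogonal (S ⊔ C) := hL ▸ Submodule.mem_sup_left h3
    have k : s - c = l - r := by
      rw [sub_eq_sub_iff_add_eq_add, ← e]
    have k0 : s - c = 0 := by
      refine (Submodule.disjoint_def.1 hW) _ (sub_mem (Submodule.mem_sup_left h1)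
        (Submodule.mem_sup_right h4)) ?_
      rw [k]
      exact sub_mem hlW hrW
    have k1 : l = r := by
      rw [k0] at k
      exact sub_eq_zero.1 k.symm
    have hs0 : s = 0 := hSCd s h1 (by rw [sub_eq_zero.1 k0]; exact hCP h4)
    have hr0 : r = 0 := (Submodule.disjoint_def.1 hL') r (k1 ▸ h3) h2
    simp [hs0, hr0]
  · rw [codisjoint_iff, eq_top_iff, ← hWc.sup_eq_top, ← hL]
    refine sup_le (sup_le (hST.trans le_sup_left) (le_sup_right.trans le_sup_right))
      (sup_le (le_sup_left.trans le_sup_right) (hRT.trans le_sup_left))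

/-! ## Semi-Riemannian metrics and indefinite Kähler manifolds -/

/-- A smooth semi-Riemannian metric on a manifold `N` modelled on `E`. -/
structure SemiRiemannianMetric (E : Type*) [NormedAddCommGroup E] [NormedSpace ℝ E]
    (N : Type*) [TopologicalSpace N] [ChartedSpace E N] [IsManifold 𝓘(ℝ, E) ∞ N] where
  val : ∀ x : N, TangentSpace 𝓘(ℝ, E) x →L[ℝ] TangentSpace 𝓘(ℝ, E) x →L[ℝ] ℝ
  symm : ∀ x u v, val x u v = val x v u
  nondegenerate : ∀ x u, (∀ v, val x u v = 0) → u = 0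
  smooth : ContMDiff 𝓘(ℝ, E) (𝓘(ℝ, E).prod 𝓘(ℝ, E →L[ℝ] E →L[ℝ] ℝ)) ∞
    (fun x ↦ TotalSpace.mk' (E →L[ℝ] E →L[ℝ] ℝ) x (val x))

namespace SemiRiemannianMetric

variable {E : Type*} [NormedAddCommGroup E] [NormedSpace ℝ E]
  {N : Type*} [TopologicalSpace N] [ChartedSpace E N] [IsManifold 𝓘(ℝ, E) ∞ N]

/-- The metric at `x` as a bilinear form. -/
def bilin (g : SemiRiemannianMetric E N) (x : N) :
    LinearMap.BilinForm ℝ (TangentSpace 𝓘(ℝ, E) x) :=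
  LinearMap.mk₂ ℝ (fun u v ↦ g.val x u v) (by simp) (by simp) (by simp) (by simp)

theorem bilin_apply (g : SemiRiemannianMetric E N) (x : N) (u v : TangentSpace 𝓘(ℝ, E) x) :
    g.bilin x u v = g.val x u v := rfl

theorem bilin_isSymm (g : SemiRiemannianMetric E N) (x : N) : (g.bilin x).IsSymm :=
  ⟨fun u v ↦ by simpa [bilin_apply] using g.symm x u v⟩

theorem bilin_nondegenerate (g : SemiRiemannianMetric E N) (x : N) :
    (g.bilin x).Nondegenerate :=
  ⟨fun u h ↦ g.nondegenerate x u h,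
    fun u h ↦ g.nondegenerate x u fun v ↦ by rw [g.symm]; exact h v⟩

/-- The metric has constant index `q`: at every point, `q` is the largest dimension of a subspace
on which the metric is negative definite. -/
def HasIndex (g : SemiRiemannianMetric E N) (q : ℕ) : Prop :=
  ∀ x : N, IsGreatest {n : ℕ | ∃ W : Submodule ℝ (TangentSpace 𝓘(ℝ, E) x),
    Module.finrank ℝ W = n ∧ ∀ w ∈ W, w ≠ 0 → g.val x w w < 0} q

/-- `nab` is the Levi-Civita connection of `g`: it is torsion-free and `∇g = 0`.
Here `nab σ x v` is the derivative of the vector field `σ` in the direction `v` at `x`. -/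
structure IsLeviCivita [FiniteDimensional ℝ E] (g : SemiRiemannianMetric E N)
    (nab : CovariantDerivative 𝓘(ℝ, E) E (TangentSpace 𝓘(ℝ, E) : N → Type _)) : Prop where
  torsion_free : ∀ (σ τ : ∀ x : N, TangentSpace 𝓘(ℝ, E) x) (x : N),
    MDifferentiableAt 𝓘(ℝ, E) (𝓘(ℝ, E).prod 𝓘(ℝ, E)) (fun y ↦ TotalSpace.mk' E y (σ y)) x →
    MDifferentiableAt 𝓘(ℝ, E) (𝓘(ℝ, E).prod 𝓘(ℝ, E)) (fun y ↦ TotalSpace.mk' E y (τ y)) x →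
    nab τ x (σ x) - nab σ x (τ x) = VectorField.mlieBracket 𝓘(ℝ, E) σ τ x
  metric : ∀ (σ τ : ∀ x : N, TangentSpace 𝓘(ℝ, E) x) (x : N) (v : TangentSpace 𝓘(ℝ, E) x),
    MDifferentiableAt 𝓘(ℝ, E) (𝓘(ℝ, E).prod 𝓘(ℝ, E)) (fun y ↦ TotalSpace.mk' E y (σ y)) x →
    MDifferentiableAt 𝓘(ℝ, E) (𝓘(ℝ, E).prod 𝓘(ℝ, E)) (fun y ↦ TotalSpace.mk' E y (τ y)) x →
    mvfderiv 𝓘(ℝ, E) (fun y ↦ g.val y (σ y) (τ y)) x v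
      = g.val x (nab σ x v) (τ x) + g.val x (σ x) (nab τ x v)

end SemiRiemannianMetric

/-- An indefinite Kähler manifold: a semi-Riemannian manifold of constant index `q`,
`0 < q < dim N`, with an orthogonal almost complex structure `J` that is parallel with respect to
the Levi-Civita connection `nab`. -/
structure IndefiniteKahlerManifold (E : Type*) [NormedAddCommGroup E] [NormedSpace ℝ E]
    [FiniteDimensional ℝ E]
    (N : Type*) [TopologicalSpace N] [ChartedSpace E N] [IsManifold 𝓘(ℝ, E) ∞ N] where
  g : SemiRiemannianMetric E N
  q : ℕ
  q_pos : 0 < q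
  q_lt : q < Module.finrank ℝ E
  index : g.HasIndex q
  J : ∀ x : N, TangentSpace 𝓘(ℝ, E) x →L[ℝ] TangentSpace 𝓘(ℝ, E) x
  J_smooth : ContMDiff 𝓘(ℝ, E) (𝓘(ℝ, E).prod 𝓘(ℝ, E →L[ℝ] E)) ∞
    (fun x ↦ TotalSpace.mk' (E →L[ℝ] E) x (J x))
  J_sq : ∀ x u, J x (J x u) = -u
  hermitian : ∀ x u v, g.val x (J x u) (J x v) = g.val x u v
  nab : CovariantDerivative 𝓘(ℝ, E) E (TangentSpace 𝓘(ℝ, E) : N → Type _)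
  leviCivita : g.IsLeviCivita nab
  J_parallel : ∀ (σ : ∀ x : N, TangentSpace 𝓘(ℝ, E) x) (x : N) (v : TangentSpace 𝓘(ℝ, E) x),
    MDifferentiableAt 𝓘(ℝ, E) (𝓘(ℝ, E).prod 𝓘(ℝ, E)) (fun y ↦ TotalSpace.mk' E y (σ y)) x →
    nab (fun y ↦ J y (σ y)) x v = J x (nab σ x v)

/-! ## Vector fields and bundles along a map `f : M → N` -/

section Along

variable {E : Type*} [NormedAddCommGroup E] [NormedSpace ℝ E]
  {F : Type*} [NormedAddCommGroup F] [NormedSpace ℝ F]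
  {M : Type*} [TopologicalSpace M] [ChartedSpace F M]
  {N : Type*} [TopologicalSpace N] [ChartedSpace E N] [IsManifold 𝓘(ℝ, E) ∞ N]

/-- The vector field `Y` along `f` is smooth at `p`. -/
def SmoothAlongAt (F : Type*) [NormedAddCommGroup F] [NormedSpace ℝ F] [ChartedSpace F M]
    (f : M → N) (Y : ∀ p : M, TangentSpace 𝓘(ℝ, E) (f p)) (p : M) : Prop :=
  ContMDiffAt 𝓘(ℝ, F) (𝓘(ℝ, E).prod 𝓘(ℝ, E)) ∞
    (fun q ↦ (TotalSpace.mk' E (f q) (Y q) : TangentBundle 𝓘(ℝ, E) N)) p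

/-- `D` is a smooth vector subbundle of `TN` restricted to `M` (that is, of `f^* TN`):
near every point it has a smooth frame. -/
def IsSubbundleAlong (F : Type*) [NormedAddCommGroup F] [NormedSpace ℝ F] [ChartedSpace F M]
    (f : M → N) (D : ∀ p : M, Submodule ℝ (TangentSpace 𝓘(ℝ, E) (f p))) : Prop :=
  ∀ p : M, ∃ (k : ℕ) (e : Fin k → ∀ q : M, TangentSpace 𝓘(ℝ, E) (f q)) (U : Set M),
    IsOpen U ∧ p ∈ U ∧ (∀ i, ∀ q ∈ U, SmoothAlongAt F f (e i) q) ∧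
    ∀ q ∈ U, LinearIndependent ℝ (fun i ↦ e i q) ∧
      Submodule.span ℝ (Set.range fun i ↦ e i q) = D q

/-- `Y ∈ Γ(D)`: `Y` is a smooth section of `D`. -/
def IsSectionOf (F : Type*) [NormedAddCommGroup F] [NormedSpace ℝ F] [ChartedSpace F M]
    (f : M → N) (D : ∀ p : M, Submodule ℝ (TangentSpace 𝓘(ℝ, E) (f p)))
    (Y : ∀ p : M, TangentSpace 𝓘(ℝ, E) (f p)) : Prop :=
  (∀ p, SmoothAlongAt F f Y p) ∧ ∀ p, Y p ∈ D p

/-- The connection `nab` on `N`, acting on vector fields along `f` (the pull-back connection):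
the derivative of `Y` at `p` in the direction `v ∈ T_p M`. In the local frame `b i` of `TN` given by
the chart at `f p`, `Y = ∑ i, y i • b i` and the derivative is
`∑ i, d(y i)(v) • b i + ∑ i, y i • nab (b i) (df v)`. The second sum is the derivative of the vector
field on `N` with the constant components `y i (p)`, which is `FiberBundle.extend E (Y p)`. -/
def covAlong (nab : CovariantDerivative 𝓘(ℝ, E) E (TangentSpace 𝓘(ℝ, E) : N → Type _))
    (f : M → N) (Y : ∀ p : M, TangentSpace 𝓘(ℝ, E) (f p)) (p : M) (v : TangentSpace 𝓘(ℝ, F) p) :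
    TangentSpace 𝓘(ℝ, E) (f p) :=
  (trivializationAt E (TangentSpace 𝓘(ℝ, E) : N → Type _) (f p)).symm (f p)
      (mvfderiv 𝓘(ℝ, F) (fun q ↦
        ((trivializationAt E (TangentSpace 𝓘(ℝ, E) : N → Type _) (f p))
          (TotalSpace.mk' E (f q) (Y q))).2) p v)
    + nab (FiberBundle.extend E (Y p)) (f p) (mfderiv 𝓘(ℝ, F) 𝓘(ℝ, E) f p v)

/-- The tangent spaces of the immersed submanifold `f : M → N`, inside `TN`. -/
def tangentAlong (F : Type*) [NormedAddCommGroup F] [NormedSpace ℝ F] [ChartedSpace F M]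
    (f : M → N) (p : M) : Submodule ℝ (TangentSpace 𝓘(ℝ, E) (f p)) :=
  LinearMap.range (mfderiv 𝓘(ℝ, F) 𝓘(ℝ, E) f p).toLinearMap

/-- The normal spaces `TM^⊥`. -/
def normalAlong (F : Type*) [NormedAddCommGroup F] [NormedSpace ℝ F] [ChartedSpace F M]
    (g : SemiRiemannianMetric E N) (f : M → N) (p : M) :
    Submodule ℝ (TangentSpace 𝓘(ℝ, E) (f p)) :=
  (g.bilin (f p)).orthogonal (tangentAlong F f p)

/-- The radical `Rad(TM) = TM ∩ TM^⊥`. -/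
def radAlong (F : Type*) [NormedAddCommGroup F] [NormedSpace ℝ F] [ChartedSpace F M]
    (g : SemiRiemannianMetric E N) (f : M → N) (p : M) :
    Submodule ℝ (TangentSpace 𝓘(ℝ, E) (f p)) :=
  tangentAlong F f p ⊓ normalAlong F g f p

end Along

/-- `C` is the (internal) direct sum of `A` and `B`. -/
def IsDirectSum {V : Type*} [AddCommGroup V] [Module ℝ V] (A B C : Submodule ℝ V) : Prop :=
  A ⊔ B = C ∧ Disjoint A B

/-! ## Lightlike submanifolds -/

/-- A lightlike submanifold `(M, g, S(TM), S(TM^⊥))` with a lightlike transversal bundle `ltr(TM)`: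
an immersion `f : M → N` such that `Rad(TM)` has constant rank `r ≥ 1`, a complement `scr = S(TM)`
of `Rad(TM)` in `TM`, a complement `coscr = S(TM^⊥)` of `Rad(TM)` in `TM^⊥`, and an isotropic
complement `ltr = ltr(TM)` of `Rad(TM)` in the orthogonal complement of `S(TM) ⊥ S(TM^⊥)`. -/
structure LightlikeSubmanifold {E : Type*} [NormedAddCommGroup E] [NormedSpace ℝ E]
    {N : Type*} [TopologicalSpace N] [ChartedSpace E N] [IsManifold 𝓘(ℝ, E) ∞ N]
    (g : SemiRiemannianMetric E N)
    (F : Type*) [NormedAddCommGroup F] [NormedSpace ℝ F]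
    (M : Type*) [TopologicalSpace M] [ChartedSpace F M] [IsManifold 𝓘(ℝ, F) ∞ M] where
  f : M → N
  smooth : ContMDiff 𝓘(ℝ, F) 𝓘(ℝ, E) ∞ f
  immersion : ∀ p, Function.Injective (mfderiv 𝓘(ℝ, F) 𝓘(ℝ, E) f p)
  r : ℕ
  r_pos : 1 ≤ r
  rank_rad : ∀ p, Module.finrank ℝ (radAlong F g f p) = r
  scr : ∀ p, Submodule ℝ (TangentSpace 𝓘(ℝ, E) (f p))
  scr_subbundle : IsSubbundleAlong F f scr
  tangent_eq : ∀ p, IsDirectSum (scr p) (radAlong F g f p) (tangentAlong F f p)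
  coscr : ∀ p, Submodule ℝ (TangentSpace 𝓘(ℝ, E) (f p))
  coscr_subbundle : IsSubbundleAlong F f coscr
  normal_eq : ∀ p, IsDirectSum (coscr p) (radAlong F g f p) (normalAlong F g f p)
  ltr : ∀ p, Submodule ℝ (TangentSpace 𝓘(ℝ, E) (f p))
  ltr_subbundle : IsSubbundleAlong F f ltr
  ltr_compl : ∀ p, IsDirectSum (ltr p) (radAlong F g f p)
    ((g.bilin (f p)).orthogonal (scr p ⊔ coscr p))
  ltr_isotropic : ∀ p, ∀ u ∈ ltr p, ∀ v ∈ ltr p, g.val (f p) u v = 0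

namespace LightlikeSubmanifold

variable {E : Type*} [NormedAddCommGroup E] [NormedSpace ℝ E] [FiniteDimensional ℝ E]
  {N : Type*} [TopologicalSpace N] [ChartedSpace E N] [IsManifold 𝓘(ℝ, E) ∞ N]
  {g : SemiRiemannianMetric E N}
  {F : Type*} [NormedAddCommGroup F] [NormedSpace ℝ F]
  {M : Type*} [TopologicalSpace M] [ChartedSpace F M] [IsManifold 𝓘(ℝ, F) ∞ M]

/-- The transversal bundle `tr(TM) = ltr(TM) ⊥ S(TM^⊥)`. -/
def tr (L : LightlikeSubmanifold g F M) (p : M) : Submodule ℝ (TangentSpace 𝓘(ℝ, E) (L.f p)) :=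
  L.ltr p ⊔ L.coscr p

/-- `TN|_M = TM ⊕ tr(TM)`. -/
theorem isCompl_tr (L : LightlikeSubmanifold g F M) (p : M) :
    IsCompl (tangentAlong F L.f p) (L.tr p) :=
  haveI : FiniteDimensional ℝ (TangentSpace 𝓘(ℝ, E) (L.f p)) :=
    inferInstanceAs (FiniteDimensional ℝ E)
  isCompl_of_screens (g.bilin (L.f p)) (g.bilin_nondegenerate _) (g.bilin_isSymm _)
    (tangentAlong F L.f p) (L.scr p) (L.coscr p) (L.ltr p)
    (L.tangent_eq p).1 (L.tangent_eq p).2 (L.normal_eq p).1 (L.normal_eq p).2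
    (L.ltr_compl p).1 (L.ltr_compl p).2

/-- The tangential part of a vector of `TN|_M = TM ⊕ tr(TM)`. -/
def tangentialPart (L : LightlikeSubmanifold g F M) (p : M) :
    TangentSpace 𝓘(ℝ, E) (L.f p) →ₗ[ℝ] TangentSpace 𝓘(ℝ, E) (L.f p) :=
  (tangentAlong F L.f p).projection (L.tr p) (L.isCompl_tr p)

/-- The vector of `T_p M` that corresponds to a vector `u ∈ df(T_p M)`. -/
def tangentLift (L : LightlikeSubmanifold g F M) (p : M) (u : TangentSpace 𝓘(ℝ, E) (L.f p)) :
    TangentSpace 𝓘(ℝ, F) p :=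
  Function.invFun (mfderiv 𝓘(ℝ, F) 𝓘(ℝ, E) L.f p) u

/-- The ambient derivative of `Y ∈ Γ(TN|_M)` in the direction of `X ∈ Γ(TM)`. -/
def ambientDeriv (L : LightlikeSubmanifold g F M)
    (nab : CovariantDerivative 𝓘(ℝ, E) E (TangentSpace 𝓘(ℝ, E) : N → Type _))
    (X Y : ∀ p : M, TangentSpace 𝓘(ℝ, E) (L.f p)) (p : M) : TangentSpace 𝓘(ℝ, E) (L.f p) :=
  covAlong nab L.f Y p (L.tangentLift p (X p))

/-- The induced connection `∇_X Y` on `M`, the tangential part of the ambient derivative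
(`X, Y ∈ Γ(TM)`). -/
def inducedDeriv (L : LightlikeSubmanifold g F M)
    (nab : CovariantDerivative 𝓘(ℝ, E) E (TangentSpace 𝓘(ℝ, E) : N → Type _))
    (X Y : ∀ p : M, TangentSpace 𝓘(ℝ, E) (L.f p)) (p : M) : TangentSpace 𝓘(ℝ, E) (L.f p) :=
  L.tangentialPart p (L.ambientDeriv nab X Y p)

/-- The shape operator `A_V X`: minus the tangential part of the ambient derivative of
`V ∈ Γ(tr(TM))` in the direction of `X ∈ Γ(TM)`. -/
def shapeOperator (L : LightlikeSubmanifold g F M)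
    (nab : CovariantDerivative 𝓘(ℝ, E) E (TangentSpace 𝓘(ℝ, E) : N → Type _))
    (V X : ∀ p : M, TangentSpace 𝓘(ℝ, E) (L.f p)) (p : M) : TangentSpace 𝓘(ℝ, E) (L.f p) :=
  -L.tangentialPart p (L.ambientDeriv nab X V p)

end LightlikeSubmanifold

/-! ## Screen transversal Cauchy-Riemann lightlike submanifolds -/

/-- The structure of a screen transversal Cauchy-Riemann (STCR) lightlike submanifold: the
decompositions `Rad(TM) = D₁ ⊕ D₂`, `J D₁ ⊆ S(TM)`, `J D₂ ⊆ S(TM^⊥)`,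
`S(TM) = {J D₁ ⊕ D'} ⊥ D₀`, `J D₀ = D₀`, `J D' = L₁ ⊥ S`, with `D₀` nondegenerate,
`L₁ ⊆ ltr(TM)` and `S ⊆ S(TM^⊥)`. -/
structure STCRStructure {E : Type*} [NormedAddCommGroup E] [NormedSpace ℝ E]
    [FiniteDimensional ℝ E]
    {N : Type*} [TopologicalSpace N] [ChartedSpace E N] [IsManifold 𝓘(ℝ, E) ∞ N]
    (K : IndefiniteKahlerManifold E N)
    {F : Type*} [NormedAddCommGroup F] [NormedSpace ℝ F]
    {M : Type*} [TopologicalSpace M] [ChartedSpace F M] [IsManifold 𝓘(ℝ, F) ∞ M]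
    (L : LightlikeSubmanifold K.g F M) where
  D₁ : ∀ p, Submodule ℝ (TangentSpace 𝓘(ℝ, E) (L.f p))
  D₂ : ∀ p, Submodule ℝ (TangentSpace 𝓘(ℝ, E) (L.f p))
  D₀ : ∀ p, Submodule ℝ (TangentSpace 𝓘(ℝ, E) (L.f p))
  D' : ∀ p, Submodule ℝ (TangentSpace 𝓘(ℝ, E) (L.f p))
  L₁ : ∀ p, Submodule ℝ (TangentSpace 𝓘(ℝ, E) (L.f p))
  S : ∀ p, Submodule ℝ (TangentSpace 𝓘(ℝ, E) (L.f p))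
  D₁_subbundle : IsSubbundleAlong F L.f D₁
  D₂_subbundle : IsSubbundleAlong F L.f D₂
  D₀_subbundle : IsSubbundleAlong F L.f D₀
  D'_subbundle : IsSubbundleAlong F L.f D'
  L₁_subbundle : IsSubbundleAlong F L.f L₁
  S_subbundle : IsSubbundleAlong F L.f S
  rad_eq : ∀ p, IsDirectSum (D₁ p) (D₂ p) (radAlong F K.g L.f p)
  J_D₁ : ∀ p, (D₁ p).map (K.J (L.f p)).toLinearMap ≤ L.scr p
  J_D₂ : ∀ p, (D₂ p).map (K.J (L.f p)).toLinearMap ≤ L.coscr p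
  disjoint_D' : ∀ p, Disjoint ((D₁ p).map (K.J (L.f p)).toLinearMap) (D' p)
  scr_eq : ∀ p, IsDirectSum ((D₁ p).map (K.J (L.f p)).toLinearMap ⊔ D' p) (D₀ p) (L.scr p)
  scr_orthogonal : ∀ p, ∀ u ∈ (D₁ p).map (K.J (L.f p)).toLinearMap ⊔ D' p, ∀ v ∈ D₀ p,
    K.g.val (L.f p) u v = 0
  D₀_nondegenerate : ∀ p, ∀ u ∈ D₀ p, (∀ v ∈ D₀ p, K.g.val (L.f p) u v = 0) → u = 0
  J_D₀ : ∀ p, (D₀ p).map (K.J (L.f p)).toLinearMap = D₀ p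
  L₁_le : ∀ p, L₁ p ≤ L.ltr p
  S_le : ∀ p, S p ≤ L.coscr p
  J_D' : ∀ p, IsDirectSum (L₁ p) (S p) ((D' p).map (K.J (L.f p)).toLinearMap)
  L₁_orthogonal_S : ∀ p, ∀ u ∈ L₁ p, ∀ v ∈ S p, K.g.val (L.f p) u v = 0

namespace STCRStructure

variable {E : Type*} [NormedAddCommGroup E] [NormedSpace ℝ E] [FiniteDimensional ℝ E]
  {N : Type*} [TopologicalSpace N] [ChartedSpace E N] [IsManifold 𝓘(ℝ, E) ∞ N]
  {K : IndefiniteKahlerManifold E N}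
  {F : Type*} [NormedAddCommGroup F] [NormedSpace ℝ F]
  {M : Type*} [TopologicalSpace M] [ChartedSpace F M] [IsManifold 𝓘(ℝ, F) ∞ M]
  {L : LightlikeSubmanifold K.g F M}

/-- `J X` for a vector field `X` along the submanifold. -/
def applyJ (_ : STCRStructure K L) (X : ∀ p : M, TangentSpace 𝓘(ℝ, E) (L.f p)) (p : M) :
    TangentSpace 𝓘(ℝ, E) (L.f p) :=
  K.J (L.f p) (X p)

/-- The sum `(J D₁ ⊕ D') ⊕ Rad(TM) ⊕ tr(TM)` of the other summands of
`TN|_M = {J D₁ ⊕ D'} ⊥ D₀ ⊥ Rad(TM) ⊕ tr(TM)`. -/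
def rest (Q : STCRStructure K L) (p : M) : Submodule ℝ (TangentSpace 𝓘(ℝ, E) (L.f p)) :=
  ((Q.D₁ p).map (K.J (L.f p)).toLinearMap ⊔ Q.D' p) ⊔ radAlong F K.g L.f p ⊔ L.tr p

theorem isCompl_rest (Q : STCRStructure K L) (p : M) : IsCompl (Q.D₀ p) (Q.rest p) := by
  have hD : Q.D₀ p ≤ L.scr p := (Q.scr_eq p).1 ▸ le_sup_right
  have hT : Q.D₀ p ≤ tangentAlong F L.f p := hD.trans ((L.tangent_eq p).1 ▸ le_sup_left)
  have hrest : Q.rest p ≤ (K.g.bilin (L.f p)).orthogonal (Q.D₀ p) := by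
    have h1 : normalAlong F K.g L.f p ≤ (K.g.bilin (L.f p)).orthogonal (Q.D₀ p) :=
      LinearMap.BilinForm.orthogonal_le hT
    refine sup_le (sup_le ?_ (inf_le_right.trans h1)) (sup_le ?_ ?_)
    · intro u hu v hv
      have := Q.scr_orthogonal p u hu v hv
      rw [K.g.symm] at this
      exact this
    · have h2 : L.ltr p ≤ (K.g.bilin (L.f p)).orthogonal (L.scr p ⊔ L.coscr p) :=
        (L.ltr_compl p).1 ▸ le_sup_left
      exact h2.trans (LinearMap.BilinForm.orthogonal_le (hD.trans le_sup_left))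
    · have h3 : L.coscr p ≤ normalAlong F K.g L.f p := (L.normal_eq p).1 ▸ le_sup_left
      exact h3.trans h1
  constructor
  · rw [Submodule.disjoint_def]
    intro x hx hx'
    refine Q.D₀_nondegenerate p x hx fun v hv ↦ ?_
    rw [K.g.symm]
    exact hrest hx' v hv
  · rw [codisjoint_iff, eq_top_iff, ← (L.isCompl_tr p).sup_eq_top, ← (L.tangent_eq p).1,
      ← (Q.scr_eq p).1]
    refine sup_le (sup_le (sup_le ?_ le_sup_left) ?_) ?_
    · exact (le_sup_left.trans le_sup_left).trans le_sup_right
    · exact (le_sup_right.trans le_sup_left).trans le_sup_right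
    · exact le_sup_right.trans le_sup_right

/-- The component in `D₀` of a vector of `TN|_M`. -/
def D₀Component (Q : STCRStructure K L) (p : M) :
    TangentSpace 𝓘(ℝ, E) (L.f p) →ₗ[ℝ] TangentSpace 𝓘(ℝ, E) (L.f p) :=
  (Q.D₀ p).projection (Q.rest p) (Q.isCompl_rest p)

/-- The `J`-invariant distribution `D₀` of `M` is minimal: `∇_X X + ∇_{JX} JX` is a section of `D₀`
for every `X ∈ Γ(D₀)`, where `∇` is the induced connection of `M`. -/
def IsMinimalD₀ (Q : STCRStructure K L) : Prop :=
  ∀ X : ∀ p : M, TangentSpace 𝓘(ℝ, E) (L.f p), IsSectionOf F L.f Q.D₀ X →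
    ∀ p : M, L.inducedDeriv K.nab X X p
      + L.inducedDeriv K.nab (Q.applyJ X) (Q.applyJ X) p ∈ Q.D₀ p

end STCRStructure

end

/-! Write `dbar X Y` for ∇̄_{JX} Y − J ∇̄_X Y, where ∇̄ is the ambient connection along the
submanifold. Since J is parallel and J² = −1, `dbar` is J-linear in `Y` and J-antilinear in `X`.
Both sides of the equivalence are statements about `dbar` on sections of `D₀`.

On one side, ∇_X X + ∇_{JX} JX is the tangential part of J `dbar X X`
(`inducedDeriv_add_inducedDeriv`), and `dbar X X` is itself tangent to M because ∇̄ has no torsion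
(`dbar_self_mem_tangentAlong`). On the other side, metric compatibility gives g(A_V JX + J A_V X, Y)
= g(V, `dbar X Y`) (`val_shapeOperator_add`). As `D₀` is nondegenerate and orthogonal to the other
summands, the condition on shape operators says exactly that `L₁` is orthogonal to every `dbar X Y`.

What remains is algebra. If J `dbar X X` has tangential part in `D₀`, then `L₁` is orthogonal to
`dbar X X` and to J `dbar X X` (`val_L₁_eq_zero_of_tangentialPart_mem`). Polarization and the two
types of J-linearity upgrade this to `dbar X Y` (`val_dbar_eq_zero`). Conversely, a tangent vector u
such that `L₁` is orthogonal to u and Ju has no components in `D₁` and J `D₁`, because `L₁`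
separates `D₁`; J then sends its other components into `D₀` or tr(TM) (`tangentialPart_J_mem_D₀`).

The analytic part transfers metric compatibility, parallelism of J and vanishing torsion from vector
fields on N to vector fields along f. In chart coordinates `covAlong` is the derivative of the
coordinates plus the ambient derivative of a field with constant coordinates, so each transfer
compares a product rule with the ambient identity for such fields. -/

noncomputable section

/-! ### Product rule and tangential torsion in coordinates -/

section Calculus

theorem HasMFDerivAt.mvfderiv_eq {F : Type*} [NormedAddCommGroup F] [NormedSpace ℝ F]
    {M : Type*} [TopologicalSpace M] [ChartedSpace F M]
    {E : Type*} [NormedAddCommGroup E] [NormedSpace ℝ E] {h : M → E} {p : M}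
    {h' : TangentSpace 𝓘(ℝ, F) p →L[ℝ] E} (hh : HasMFDerivAt 𝓘(ℝ, F) 𝓘(ℝ, E) h p h') :
    mvfderiv 𝓘(ℝ, F) h p = h' := by
  ext v
  rw [mvfderiv, hh.mfderiv]
  rfl

theorem Filter.EventuallyEq.mvfderiv_eq {F : Type*} [NormedAddCommGroup F] [NormedSpace ℝ F]
    {M : Type*} [TopologicalSpace M] [ChartedSpace F M]
    {E : Type*} [NormedAddCommGroup E] [NormedSpace ℝ E] {h k : M → E} {p : M}
    (hh : h =ᶠ[nhds p] k) : mvfderiv 𝓘(ℝ, F) h p = mvfderiv 𝓘(ℝ, F) k p := by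
  ext v
  rw [mvfderiv, mvfderiv, hh.mfderiv_eq]
  rfl

theorem mvfderiv_clm_apply {F : Type*} [NormedAddCommGroup F] [NormedSpace ℝ F]
    {M : Type*} [TopologicalSpace M] [ChartedSpace F M]
    {E : Type*} [NormedAddCommGroup E] [NormedSpace ℝ E]
    {G : Type*} [NormedAddCommGroup G] [NormedSpace ℝ G]
    {A : M → E →L[ℝ] G} {y : M → E} {p : M}
    (hA : MDifferentiableAt 𝓘(ℝ, F) 𝓘(ℝ, E →L[ℝ] G) A p)
    (hy : MDifferentiableAt 𝓘(ℝ, F) 𝓘(ℝ, E) y p) (v : TangentSpace 𝓘(ℝ, F) p) :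
    mvfderiv 𝓘(ℝ, F) (fun q ↦ A q (y q)) p v
      = mvfderiv 𝓘(ℝ, F) A p v (y p) + A p (mvfderiv 𝓘(ℝ, F) y p v) := by
  -- The tangent space at `p` is `F` by definition; restating the derivatives over `F` puts them in
  -- the form of the normed-space product rule.
  let A' : F →L[ℝ] E →L[ℝ] G := mvfderiv 𝓘(ℝ, F) A p
  let y' : F →L[ℝ] E := mvfderiv 𝓘(ℝ, F) y p
  let D : F →L[ℝ] G := (A p).comp y' + A'.flip (y p)
  have h : HasMFDerivAt 𝓘(ℝ, F) 𝓘(ℝ, G) (fun q ↦ A q (y q)) p D := by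
    refine ⟨(hA.clm_apply hy).continuousAt, ?_⟩
    have h1 := hA.hasMFDerivAt.2
    have h2 := hy.hasMFDerivAt.2
    have h3 := HasFDerivWithinAt.clm_apply h1 h2
    have e : (extChartAt 𝓘(ℝ, F) p).symm (extChartAt 𝓘(ℝ, F) p p) = p := by simp
    simp only [writtenInExtChartAt, extChartAt_model_space_eq_id, PartialEquiv.refl_coe,
      Function.comp_def, id_eq] at h3 ⊢
    rw [e] at h3
    exact h3
  rw [h.mvfderiv_eq]
  exact add_comm _ _

/-- Lift the fields to the source: a = dφ(x) and b = dφ(y) with x, y differentiable. Differentiating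
gives D²φ terms and terms in the range of dφ; the former cancel in the difference by symmetry of the
second derivative. -/
theorem sub_fderiv_mem_range_of_mem_range
    {F : Type*} [NormedAddCommGroup F] [NormedSpace ℝ F] [FiniteDimensional ℝ F]
    {E : Type*} [NormedAddCommGroup E] [NormedSpace ℝ E] [FiniteDimensional ℝ E]
    {φ : F → E} {z : F} (hφ : ContDiffAt ℝ 2 φ z) (hi : Function.Injective (fderiv ℝ φ z))
    {a b : F → E} (ha : DifferentiableAt ℝ a z) (hb : DifferentiableAt ℝ b z)
    (har : ∀ᶠ y in nhds z, a y ∈ (fderiv ℝ φ y).range)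
    (hbr : ∀ᶠ y in nhds z, b y ∈ (fderiv ℝ φ y).range)
    {u v : F} (hu : fderiv ℝ φ z u = a z) (hv : fderiv ℝ φ z v = b z) :
    fderiv ℝ b z u - fderiv ℝ a z v ∈ (fderiv ℝ φ z).range := by
  obtain ⟨ℓ, hℓ⟩ : ∃ ℓ : E →L[ℝ] F, ℓ ∘L fderiv ℝ φ z = 1 := by
    obtain ⟨l, hl⟩ := LinearMap.exists_leftInverse_of_injective (fderiv ℝ φ z).toLinearMap
      (LinearMap.ker_eq_bot.2 hi)
    refine ⟨l.toContinuousLinearMap, ?_⟩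
    ext w
    exact LinearMap.congr_fun hl w
  have hA : DifferentiableAt ℝ (fderiv ℝ φ) z :=
    (hφ.fderiv_right (m := 1) (by norm_num)).differentiableAt (by norm_num)
  have hB : DifferentiableAt ℝ (fun y ↦ ℓ ∘L fderiv ℝ φ y) z :=
    (differentiableAt_const ℓ).clm_comp hA
  have hU : IsUnit (ℓ ∘L fderiv ℝ φ z) := by rw [hℓ]; exact isUnit_one
  have hev : ∀ᶠ y in nhds z, IsUnit (ℓ ∘L fderiv ℝ φ y) :=
    hB.continuousAt.eventually (Units.isOpen.mem_nhds hU)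
  have key : ∀ {c : F → E} (_ : DifferentiableAt ℝ c z)
      (_ : ∀ᶠ y in nhds z, c y ∈ (fderiv ℝ φ y).range) {w : F} (_ : fderiv ℝ φ z w = c z)
      (d : F), fderiv ℝ c z d - fderiv ℝ (fderiv ℝ φ) z d w ∈ (fderiv ℝ φ z).range := by
    intro c hc hcr w hw d
    -- A left inverse `ℓ` of dφ at `z` alone suffices: `ℓ ∘ dφ_y` stays invertible near `z`, and its
    -- inverse recovers the lift of `c` differentiably.
    set x : F → F := fun y ↦ Ring.inverse (ℓ ∘L fderiv ℝ φ y) (ℓ (c y)) with hx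
    have hxd : DifferentiableAt ℝ x z :=
      (hB.inverse hU).clm_apply (ℓ.differentiableAt.comp z hc)
    have hcx : c =ᶠ[nhds z] fun y ↦ fderiv ℝ φ y (x y) := by
      filter_upwards [hcr, hev] with y hy hy'
      obtain ⟨t, ht⟩ := hy
      have : x y = t := by
        simp only [hx]
        rw [← ht]
        have := congrArg (fun T : F →L[ℝ] F ↦ T t) (Ring.inverse_mul_cancel _ hy')
        simpa using this
      rw [this]
      exact ht.symm
    have hxz : x z = w := hi (by rw [hw]; exact hcx.self_of_nhds.symm)
    rw [hcx.fderiv_eq, fderiv_clm_apply hA hxd]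
    simp [hxz]
  have h1 := key hb hbr hv u
  have h2 := key ha har hu v
  have hsym : fderiv ℝ (fderiv ℝ φ) z u v = fderiv ℝ (fderiv ℝ φ) z v u :=
    (hφ.isSymmSndFDerivAt (by simp)).eq u v
  have h3 := sub_mem h1 h2
  rw [hsym] at h3
  simpa using h3

end Calculus

/-! ### Coordinates of tangent vectors in a chart frame -/

section Trivialization

variable {E : Type*} [NormedAddCommGroup E] [NormedSpace ℝ E]
  {N : Type*} [TopologicalSpace N] [ChartedSpace E N] [IsManifold 𝓘(ℝ, E) ∞ N]

/-- The coordinates of a tangent vector at `x` in the frame given by the chart at `x₀`. -/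
def tangentCoord (x₀ x : N) : TangentSpace 𝓘(ℝ, E) x →L[ℝ] E :=
  (trivializationAt E (TangentSpace 𝓘(ℝ, E) : N → Type _) x₀).continuousLinearMapAt ℝ x

/-- The tangent vector at `x` with given coordinates in the frame given by the chart at `x₀`. -/
def tangentOfCoord (x₀ x : N) : E →L[ℝ] TangentSpace 𝓘(ℝ, E) x :=
  (trivializationAt E (TangentSpace 𝓘(ℝ, E) : N → Type _) x₀).symmL ℝ x

theorem tangentCoord_apply {x₀ x : N} (hx : x ∈ (chartAt E x₀).source)
    (u : TangentSpace 𝓘(ℝ, E) x) : tangentCoord x₀ x u =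
      (trivializationAt E (TangentSpace 𝓘(ℝ, E) : N → Type _) x₀ (TotalSpace.mk' E x u)).2 := by
  have hx' : x ∈ (trivializationAt E (TangentSpace 𝓘(ℝ, E) : N → Type _) x₀).baseSet := hx
  rw [tangentCoord, Trivialization.continuousLinearMapAt_apply,
    Trivialization.coe_linearMapAt_of_mem _ hx']

theorem tangentOfCoord_apply {x₀ x : N} (hx : x ∈ (chartAt E x₀).source) (c : E) :
    tangentOfCoord x₀ x c =
      (trivializationAt E (TangentSpace 𝓘(ℝ, E) : N → Type _) x₀).symm x c :=
  Trivialization.symmL_apply _ (b := x) hx c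

theorem tangentOfCoord_tangentCoord {x₀ x : N} (hx : x ∈ (chartAt E x₀).source)
    (u : TangentSpace 𝓘(ℝ, E) x) : tangentOfCoord x₀ x (tangentCoord x₀ x u) = u :=
  (trivializationAt E (TangentSpace 𝓘(ℝ, E) : N → Type _) x₀).symmL_continuousLinearMapAt hx u

theorem tangentCoord_tangentOfCoord {x₀ x : N} (hx : x ∈ (chartAt E x₀).source) (c : E) :
    tangentCoord x₀ x (tangentOfCoord x₀ x c) = c :=
  (trivializationAt E (TangentSpace 𝓘(ℝ, E) : N → Type _) x₀).continuousLinearMapAt_symmL hx c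

theorem extend_eq_tangentOfCoord {x₀ x : N} (hx : x ∈ (chartAt E x₀).source)
    (u : TangentSpace 𝓘(ℝ, E) x₀) :
    FiberBundle.extend E u x = tangentOfCoord x₀ x (tangentCoord x₀ x₀ u) := by
  rw [tangentCoord_apply (mem_chart_source E x₀), tangentOfCoord_apply hx]
  rfl

end Trivialization

/-! ### The pull-back connection in coordinates -/

section Along

variable {E : Type*} [NormedAddCommGroup E] [NormedSpace ℝ E]
  {F : Type*} [NormedAddCommGroup F] [NormedSpace ℝ F]
  {M : Type*} [TopologicalSpace M] [ChartedSpace F M]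
  {N : Type*} [TopologicalSpace N] [ChartedSpace E N] [IsManifold 𝓘(ℝ, E) ∞ N]
  {f : M → N} {Y Z : ∀ p : M, TangentSpace 𝓘(ℝ, E) (f p)} {p : M}

theorem eventually_tangentCoord (hf : ContinuousAt f p)
    (Y : ∀ p : M, TangentSpace 𝓘(ℝ, E) (f p)) :
    (fun q ↦ (trivializationAt E (TangentSpace 𝓘(ℝ, E) : N → Type _) (f p)
      (TotalSpace.mk' E (f q) (Y q))).2) =ᶠ[nhds p] fun q ↦ tangentCoord (f p) (f q) (Y q) := by
  filter_upwards [hf.eventually (chart_source_mem_nhds E (f p))] with q hq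
  exact (tangentCoord_apply hq _).symm

theorem smoothAlongAt_iff (hf : ContMDiffAt 𝓘(ℝ, F) 𝓘(ℝ, E) ∞ f p) :
    SmoothAlongAt F f Y p ↔
      ContMDiffAt 𝓘(ℝ, F) 𝓘(ℝ, E) ∞ (fun q ↦ tangentCoord (f p) (f q) (Y q)) p := by
  rw [SmoothAlongAt, contMDiffAt_totalSpace]
  have h := (eventually_tangentCoord hf.continuousAt Y).contMDiffAt_iff
    (I := 𝓘(ℝ, F)) (I' := 𝓘(ℝ, E)) (n := ∞)
  exact ⟨fun h' ↦ h.1 h'.2, fun h' ↦ ⟨hf, h.2 h'⟩⟩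

theorem SmoothAlongAt.mdifferentiableAt (hf : ContMDiffAt 𝓘(ℝ, F) 𝓘(ℝ, E) ∞ f p)
    (hY : SmoothAlongAt F f Y p) :
    MDifferentiableAt 𝓘(ℝ, F) 𝓘(ℝ, E) (fun q ↦ tangentCoord (f p) (f q) (Y q)) p :=
  ((smoothAlongAt_iff hf).1 hY).mdifferentiableAt (by simp)

theorem SmoothAlongAt.add (hf : ContMDiffAt 𝓘(ℝ, F) 𝓘(ℝ, E) ∞ f p)
    (hY : SmoothAlongAt F f Y p) (hZ : SmoothAlongAt F f Z p) :
    SmoothAlongAt F f (fun q ↦ Y q + Z q) p := by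
  rw [smoothAlongAt_iff hf] at *
  simp only [map_add]
  exact hY.add hZ

theorem SmoothAlongAt.smul (hf : ContMDiffAt 𝓘(ℝ, F) 𝓘(ℝ, E) ∞ f p) {c : M → ℝ}
    (hc : ContMDiffAt 𝓘(ℝ, F) 𝓘(ℝ, ℝ) ∞ c p) (hY : SmoothAlongAt F f Y p) :
    SmoothAlongAt F f (fun q ↦ c q • Y q) p := by
  rw [smoothAlongAt_iff hf] at *
  simp only [map_smul]
  exact hc.smul hY

theorem SmoothAlongAt.sum (hf : ContMDiffAt 𝓘(ℝ, F) 𝓘(ℝ, E) ∞ f p) {ι : Type*} (s : Finset ι)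
    {W : ι → ∀ p : M, TangentSpace 𝓘(ℝ, E) (f p)} (hW : ∀ i ∈ s, SmoothAlongAt F f (W i) p) :
    SmoothAlongAt F f (fun q ↦ ∑ i ∈ s, W i q) p := by
  rw [smoothAlongAt_iff hf]
  simp only [map_sum]
  exact ContMDiffAt.sum fun i hi ↦ (smoothAlongAt_iff hf).1 (hW i hi)

variable (nab : CovariantDerivative 𝓘(ℝ, E) E (TangentSpace 𝓘(ℝ, E) : N → Type _))

theorem covAlong_eq (hf : ContinuousAt f p) (Y : ∀ p : M, TangentSpace 𝓘(ℝ, E) (f p))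
    (v : TangentSpace 𝓘(ℝ, F) p) :
    covAlong nab f Y p v = tangentOfCoord (f p) (f p)
        (mvfderiv 𝓘(ℝ, F) (fun q ↦ tangentCoord (f p) (f q) (Y q)) p v)
      + nab (FiberBundle.extend E (Y p)) (f p) (mfderiv 𝓘(ℝ, F) 𝓘(ℝ, E) f p v) := by
  rw [covAlong, (eventually_tangentCoord hf Y).mvfderiv_eq,
    tangentOfCoord_apply (mem_chart_source E (f p))]

theorem mdifferentiableAt_section_iff_tangentCoord
    {σ : ∀ x : N, TangentSpace 𝓘(ℝ, E) x} {x : N} :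
    MDifferentiableAt 𝓘(ℝ, E) (𝓘(ℝ, E).prod 𝓘(ℝ, E)) (fun y ↦ TotalSpace.mk' E y (σ y)) x ↔
      MDifferentiableAt 𝓘(ℝ, E) 𝓘(ℝ, E) (fun y ↦ tangentCoord x y (σ y)) x := by
  rw [mdifferentiableAt_section]
  exact (eventually_tangentCoord (f := id) continuousAt_id σ).mdifferentiableAt_iff

/-- In the frame of the chart at `x` a covariant derivative is the derivative of the coordinates
plus a tensorial term. -/
theorem CovariantDerivative.apply_eq_add_extend [FiniteDimensional ℝ E]
    {σ : ∀ x : N, TangentSpace 𝓘(ℝ, E) x} {x : N}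
    (hσ : MDifferentiableAt 𝓘(ℝ, E) (𝓘(ℝ, E).prod 𝓘(ℝ, E)) (fun y ↦ TotalSpace.mk' E y (σ y)) x)
    (w : TangentSpace 𝓘(ℝ, E) x) :
    nab σ x w = tangentOfCoord x x (mvfderiv 𝓘(ℝ, E) (fun y ↦ tangentCoord x y (σ y)) x w)
      + nab (FiberBundle.extend E (σ x)) x w := by
  -- The Leibniz terms cancel in the difference of the two derivatives, so `Φ` depends only on the
  -- value of the field at `x`. It can then be evaluated on the extension with constant coordinates.
  set Φ : (∀ x : N, TangentSpace 𝓘(ℝ, E) x) → TangentSpace 𝓘(ℝ, E) x := fun τ ↦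
    nab τ x w - tangentOfCoord x x (mvfderiv 𝓘(ℝ, E) (fun y ↦ tangentCoord x y (τ y)) x w) with hΦ
  have hT : TensorialAt 𝓘(ℝ, E) E Φ x := by
    constructor
    · intro h τ hh hτ
      have h1 := nab.isCovariantDerivativeOn (s := Set.univ).leibniz hτ hh
      have h2 := mvfderiv_fun_smul hh (mdifferentiableAt_section_iff_tangentCoord.1 hτ)
      simp only [hΦ, h1, Pi.smul_apply', map_smul, h2]
      simp [tangentOfCoord_tangentCoord (mem_chart_source E x), smul_sub]
    · intro τ τ' hτ hτ'
      have h1 := nab.isCovariantDerivativeOn (s := Set.univ).add hτ hτ'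
      have h2 := mvfderiv_fun_add (mdifferentiableAt_section_iff_tangentCoord.1 hτ)
        (mdifferentiableAt_section_iff_tangentCoord.1 hτ')
      simp only [hΦ, h1, Pi.add_apply, map_add, h2]
      simp only [_root_.add_apply, map_add]
      abel
  have he : mvfderiv 𝓘(ℝ, E)
      (fun y ↦ tangentCoord x y (FiberBundle.extend E (σ x) y)) x = 0 := by
    have : (fun y ↦ tangentCoord x y (FiberBundle.extend E (σ x) y))
        =ᶠ[nhds x] fun _ ↦ tangentCoord x x (σ x) := by
      filter_upwards [chart_source_mem_nhds E x] with y hy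
      rw [extend_eq_tangentOfCoord hy, tangentCoord_tangentOfCoord hy]
    rw [this.mvfderiv_eq, mvfderiv_const]
  have h := hT.pointwise hσ (FiberBundle.mdifferentiableAt_extend 𝓘(ℝ, E) E (σ x)) (by simp)
  simp only [hΦ, he] at h
  rw [sub_eq_iff_eq_add] at h
  rw [h]
  simp [add_comm]

theorem covAlong_add (hf : ContMDiffAt 𝓘(ℝ, F) 𝓘(ℝ, E) ∞ f p)
    (hY : SmoothAlongAt F f Y p) (hZ : SmoothAlongAt F f Z p) (v : TangentSpace 𝓘(ℝ, F) p) :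
    covAlong nab f (fun q ↦ Y q + Z q) p v = covAlong nab f Y p v + covAlong nab f Z p v := by
  have hm : ∀ u : TangentSpace 𝓘(ℝ, E) (f p), MDifferentiableAt 𝓘(ℝ, E) (𝓘(ℝ, E).prod 𝓘(ℝ, E))
      (fun y ↦ TotalSpace.mk' E y (FiberBundle.extend E u y)) (f p) :=
    FiberBundle.mdifferentiableAt_extend 𝓘(ℝ, E) E
  -- `FiberBundle.extend` is additive on the chart domain, and only the germ matters to `nab`.
  have h1 : nab (FiberBundle.extend E (Y p + Z p)) (f p)
      = nab (FiberBundle.extend E (Y p) + FiberBundle.extend E (Z p)) (f p) := by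
    refine (nab.isCovariantDerivativeOn (s := Set.univ)).congr_of_eventuallyEq (hm _)
      (mdifferentiableAt_add_section (hm _) (hm _)) Filter.univ_mem ?_
    filter_upwards [chart_source_mem_nhds E (f p)] with x hx
    simp [extend_eq_tangentOfCoord hx]
  simp only [covAlong_eq nab hf.continuousAt, map_add, h1]
  rw [mvfderiv_fun_add (hY.mdifferentiableAt hf) (hZ.mdifferentiableAt hf),
    nab.isCovariantDerivativeOn (s := Set.univ).add (hm _) (hm _)]
  simp only [_root_.add_apply, map_add]
  abel

theorem covAlong_add_dir (hf : ContinuousAt f p) (v w : TangentSpace 𝓘(ℝ, F) p) :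
    covAlong nab f Y p (v + w) = covAlong nab f Y p v + covAlong nab f Y p w := by
  simp only [covAlong_eq nab hf, map_add]
  abel

end Along

theorem mvfderiv_comp_of_mdifferentiableAt
    {F : Type*} [NormedAddCommGroup F] [NormedSpace ℝ F]
    {M : Type*} [TopologicalSpace M] [ChartedSpace F M]
    {E : Type*} [NormedAddCommGroup E] [NormedSpace ℝ E]
    {N : Type*} [TopologicalSpace N] [ChartedSpace E N]
    {G : Type*} [NormedAddCommGroup G] [NormedSpace ℝ G] {h : N → G} {f : M → N} {p : M}
    (hh : MDifferentiableAt 𝓘(ℝ, E) 𝓘(ℝ, G) h (f p))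
    (hf : MDifferentiableAt 𝓘(ℝ, F) 𝓘(ℝ, E) f p) (v : TangentSpace 𝓘(ℝ, F) p) :
    mvfderiv 𝓘(ℝ, F) (h ∘ f) p v
      = mvfderiv 𝓘(ℝ, E) h (f p) (mfderiv 𝓘(ℝ, F) 𝓘(ℝ, E) f p v) :=
  mfderiv_comp_apply p hh hf v

/-! ### Parallel endomorphisms and the metric along a map -/

section Along

variable {E : Type*} [NormedAddCommGroup E] [NormedSpace ℝ E]
  {F : Type*} [NormedAddCommGroup F] [NormedSpace ℝ F]
  {M : Type*} [TopologicalSpace M] [ChartedSpace F M]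
  {N : Type*} [TopologicalSpace N] [ChartedSpace E N] [IsManifold 𝓘(ℝ, E) ∞ N]
  {f : M → N} {Y Z : ∀ p : M, TangentSpace 𝓘(ℝ, E) (f p)} {p : M}

/-- The matrix of a field of endomorphisms in the frame given by the chart at `x₀`. -/
def endCoord (A : ∀ x : N, TangentSpace 𝓘(ℝ, E) x →L[ℝ] TangentSpace 𝓘(ℝ, E) x) (x₀ x : N) :
    E →L[ℝ] E :=
  (tangentCoord x₀ x).comp ((A x).comp (tangentOfCoord x₀ x))

theorem contMDiffAt_endCoord
    {A : ∀ x : N, TangentSpace 𝓘(ℝ, E) x →L[ℝ] TangentSpace 𝓘(ℝ, E) x}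
    (hA : ContMDiff 𝓘(ℝ, E) (𝓘(ℝ, E).prod 𝓘(ℝ, E →L[ℝ] E)) ∞
      (fun x ↦ TotalSpace.mk' (E →L[ℝ] E) x (A x))) (x₀ : N) :
    ContMDiffAt 𝓘(ℝ, E) 𝓘(ℝ, E →L[ℝ] E) ∞ (endCoord A x₀) x₀ :=
  ((contMDiffAt_hom_bundle _).1 (hA x₀)).2

theorem tangentCoord_end {x₀ x : N} (hx : x ∈ (chartAt E x₀).source)
    (A : ∀ x : N, TangentSpace 𝓘(ℝ, E) x →L[ℝ] TangentSpace 𝓘(ℝ, E) x)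
    (u : TangentSpace 𝓘(ℝ, E) x) :
    tangentCoord x₀ x (A x u) = endCoord A x₀ x (tangentCoord x₀ x u) := by
  simp [endCoord, tangentOfCoord_tangentCoord hx]

theorem SmoothAlongAt.end_apply
    {A : ∀ x : N, TangentSpace 𝓘(ℝ, E) x →L[ℝ] TangentSpace 𝓘(ℝ, E) x}
    (hA : ContMDiff 𝓘(ℝ, E) (𝓘(ℝ, E).prod 𝓘(ℝ, E →L[ℝ] E)) ∞
      (fun x ↦ TotalSpace.mk' (E →L[ℝ] E) x (A x)))
    (hf : ContMDiffAt 𝓘(ℝ, F) 𝓘(ℝ, E) ∞ f p) (hY : SmoothAlongAt F f Y p) :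
    SmoothAlongAt F f (fun q ↦ A (f q) (Y q)) p := by
  rw [smoothAlongAt_iff hf] at *
  refine (((contMDiffAt_endCoord hA (f p)).comp p hf).clm_apply hY).congr_of_eventuallyEq ?_
  filter_upwards [hf.continuousAt.eventually (chart_source_mem_nhds E (f p))] with q hq
  exact tangentCoord_end hq A _

/-- Both sides differ from their tensorial parts by a product rule. The term with the derivative of
the matrix of `A` is the one that parallelism determines on fields with constant coordinates. -/
theorem covAlong_end_apply [FiniteDimensional ℝ E]
    (nab : CovariantDerivative 𝓘(ℝ, E) E (TangentSpace 𝓘(ℝ, E) : N → Type _))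
    {A : ∀ x : N, TangentSpace 𝓘(ℝ, E) x →L[ℝ] TangentSpace 𝓘(ℝ, E) x}
    (hA : ContMDiff 𝓘(ℝ, E) (𝓘(ℝ, E).prod 𝓘(ℝ, E →L[ℝ] E)) ∞
      (fun x ↦ TotalSpace.mk' (E →L[ℝ] E) x (A x)))
    (hpar : ∀ (σ : ∀ x : N, TangentSpace 𝓘(ℝ, E) x) (x : N) (v : TangentSpace 𝓘(ℝ, E) x),
      MDifferentiableAt 𝓘(ℝ, E) (𝓘(ℝ, E).prod 𝓘(ℝ, E)) (fun y ↦ TotalSpace.mk' E y (σ y)) x →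
      nab (fun y ↦ A y (σ y)) x v = A x (nab σ x v))
    (hf : ContMDiffAt 𝓘(ℝ, F) 𝓘(ℝ, E) ∞ f p) (hY : SmoothAlongAt F f Y p)
    (v : TangentSpace 𝓘(ℝ, F) p) :
    covAlong nab f (fun q ↦ A (f q) (Y q)) p v = A (f p) (covAlong nab f Y p v) := by
  have hx := mem_chart_source E (f p)
  have hd := (contMDiffAt_endCoord hA (f p)).mdifferentiableAt (by simp)
  have hdf := hf.mdifferentiableAt (by simp)
  have hYc := hY.mdifferentiableAt hf
  set w := mfderiv 𝓘(ℝ, F) 𝓘(ℝ, E) f p v with hw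
  set σ : ∀ x : N, TangentSpace 𝓘(ℝ, E) x := FiberBundle.extend E (Y p) with hσ
  have hm : MDifferentiableAt 𝓘(ℝ, E) (𝓘(ℝ, E).prod 𝓘(ℝ, E))
      (fun y ↦ TotalSpace.mk' E y (σ y)) (f p) :=
    FiberBundle.mdifferentiableAt_extend 𝓘(ℝ, E) E (Y p)
  have hσp : σ (f p) = Y p := by simp [hσ]
  set D := mvfderiv 𝓘(ℝ, E) (endCoord A (f p)) (f p) w (tangentCoord (f p) (f p) (Y p)) with hD
  have h1 : mvfderiv 𝓘(ℝ, F) (fun q ↦ tangentCoord (f p) (f q) (A (f q) (Y q))) p v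
      = D + endCoord A (f p) (f p)
        (mvfderiv 𝓘(ℝ, F) (fun q ↦ tangentCoord (f p) (f q) (Y q)) p v) := by
    have : (fun q ↦ tangentCoord (f p) (f q) (A (f q) (Y q))) =ᶠ[nhds p]
        fun q ↦ (endCoord A (f p) ∘ f) q (tangentCoord (f p) (f q) (Y q)) := by
      filter_upwards [hf.continuousAt.eventually (chart_source_mem_nhds E (f p))] with q hq
      exact tangentCoord_end hq A _
    rw [this.mvfderiv_eq, mvfderiv_clm_apply (hd.comp p hdf) hYc,
      mvfderiv_comp_of_mdifferentiableAt hd hdf]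
    rfl
  -- The coordinates of `σ` are constant, so only the matrix of `A` is differentiated.
  have h2 : mvfderiv 𝓘(ℝ, E) (fun y ↦ tangentCoord (f p) y (A y (σ y))) (f p) w = D := by
    have : (fun y ↦ tangentCoord (f p) y (A y (σ y))) =ᶠ[nhds (f p)]
        fun y ↦ endCoord A (f p) y (tangentCoord (f p) (f p) (Y p)) := by
      filter_upwards [chart_source_mem_nhds E (f p)] with y hy
      rw [tangentCoord_end hy, hσ, extend_eq_tangentOfCoord hy, tangentCoord_tangentOfCoord hy]
    rw [this.mvfderiv_eq, mvfderiv_clm_apply hd mdifferentiableAt_const, mvfderiv_const]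
    simp [hD]
  have hAσ : MDifferentiableAt 𝓘(ℝ, E) (𝓘(ℝ, E).prod 𝓘(ℝ, E))
      (fun y ↦ TotalSpace.mk' E y (A y (σ y))) (f p) :=
    ((hA (f p)).mdifferentiableAt (by simp)).clm_bundle_apply hm
  have h3 := nab.apply_eq_add_extend hAσ w
  rw [h2, hpar σ _ w hm, hσp] at h3
  rw [covAlong_eq nab hf.continuousAt, covAlong_eq nab hf.continuousAt, h1, map_add, map_add, h3]
  have h4 : ∀ c, tangentOfCoord (f p) (f p) (endCoord A (f p) (f p) c)
      = A (f p) (tangentOfCoord (f p) (f p) c) := fun c ↦ by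
    simp [endCoord, tangentOfCoord_tangentCoord hx]
  rw [h4]
  abel

/-- The matrix of the metric in the frame given by the chart at `x₀`. -/
def SemiRiemannianMetric.coord (g : SemiRiemannianMetric E N) (x₀ x : N) : E →L[ℝ] E →L[ℝ] ℝ :=
  ContinuousLinearMap.inCoordinates E (TangentSpace 𝓘(ℝ, E) : N → Type _) (E →L[ℝ] ℝ)
    (fun x : N ↦ TangentSpace 𝓘(ℝ, E) x →L[ℝ] ℝ) x₀ x x₀ x (g.val x)

theorem SemiRiemannianMetric.contMDiffAt_coord (g : SemiRiemannianMetric E N) (x₀ : N) :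
    ContMDiffAt 𝓘(ℝ, E) 𝓘(ℝ, E →L[ℝ] E →L[ℝ] ℝ) ∞ (g.coord x₀) x₀ :=
  ((contMDiffAt_hom_bundle _).1 (g.smooth x₀)).2

theorem SemiRiemannianMetric.coord_tangentCoord (g : SemiRiemannianMetric E N) {x₀ x : N}
    (hx : x ∈ (chartAt E x₀).source) (u v : TangentSpace 𝓘(ℝ, E) x) :
    g.coord x₀ x (tangentCoord x₀ x u) (tangentCoord x₀ x v) = g.val x u v := by
  have hx' : x ∈ (trivializationAt E (TangentSpace 𝓘(ℝ, E) : N → Type _) x₀).baseSet := hx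
  have h := inCoordinates_apply_eq₂ (𝕜 := ℝ) (E₁ := (TangentSpace 𝓘(ℝ, E) : N → Type _))
    (E₂ := (TangentSpace 𝓘(ℝ, E) : N → Type _)) (E₃ := Bundle.Trivial N ℝ) (F₁ := E) (F₂ := E)
    (F₃ := ℝ) (ϕ := g.val x) (v := tangentCoord x₀ x u) (w := tangentCoord x₀ x v) hx' hx'
    (Set.mem_univ _)
  refine h.trans ?_
  rw [← tangentOfCoord_apply hx, ← tangentOfCoord_apply hx, tangentOfCoord_tangentCoord hx,
    tangentOfCoord_tangentCoord hx]
  simp only [Trivial.fiberBundle_trivializationAt', Trivial.linearMapAt_trivialization]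
  rfl

/-- The product rule in coordinates has one term with the derivative of the metric matrix and two
with derivatives of coordinates. Compatibility on `N`, applied to fields with constant coordinates,
turns the first into the connection terms of `covAlong`. -/
theorem SemiRiemannianMetric.IsLeviCivita.mvfderiv_along [FiniteDimensional ℝ E]
    {g : SemiRiemannianMetric E N}
    {nab : CovariantDerivative 𝓘(ℝ, E) E (TangentSpace 𝓘(ℝ, E) : N → Type _)}
    (hnab : g.IsLeviCivita nab)
    (hf : ContMDiffAt 𝓘(ℝ, F) 𝓘(ℝ, E) ∞ f p) (hY : SmoothAlongAt F f Y p)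
    (hZ : SmoothAlongAt F f Z p) (v : TangentSpace 𝓘(ℝ, F) p) :
    mvfderiv 𝓘(ℝ, F) (fun q ↦ g.val (f q) (Y q) (Z q)) p v
      = g.val (f p) (covAlong nab f Y p v) (Z p) + g.val (f p) (Y p) (covAlong nab f Z p v) := by
  have hx := mem_chart_source E (f p)
  have hd := (g.contMDiffAt_coord (f p)).mdifferentiableAt (by simp)
  have hdf := hf.mdifferentiableAt (by simp)
  have hYc := hY.mdifferentiableAt hf
  have hZc := hZ.mdifferentiableAt hf
  set w := mfderiv 𝓘(ℝ, F) 𝓘(ℝ, E) f p v with hw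
  have hm : ∀ u : TangentSpace 𝓘(ℝ, E) (f p), MDifferentiableAt 𝓘(ℝ, E) (𝓘(ℝ, E).prod 𝓘(ℝ, E))
      (fun y ↦ TotalSpace.mk' E y (FiberBundle.extend E u y)) (f p) :=
    FiberBundle.mdifferentiableAt_extend 𝓘(ℝ, E) E
  have h1 : mvfderiv 𝓘(ℝ, F) (fun q ↦ g.val (f q) (Y q) (Z q)) p v
      = mvfderiv 𝓘(ℝ, E) (g.coord (f p)) (f p) w (tangentCoord (f p) (f p) (Y p))
          (tangentCoord (f p) (f p) (Z p))
        + g.coord (f p) (f p) (mvfderiv 𝓘(ℝ, F) (fun q ↦ tangentCoord (f p) (f q) (Y q)) p v)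
          (tangentCoord (f p) (f p) (Z p))
        + g.coord (f p) (f p) (tangentCoord (f p) (f p) (Y p))
          (mvfderiv 𝓘(ℝ, F) (fun q ↦ tangentCoord (f p) (f q) (Z q)) p v) := by
    have : (fun q ↦ g.val (f q) (Y q) (Z q)) =ᶠ[nhds p]
        fun q ↦ (g.coord (f p) ∘ f) q (tangentCoord (f p) (f q) (Y q))
          (tangentCoord (f p) (f q) (Z q)) := by
      filter_upwards [hf.continuousAt.eventually (chart_source_mem_nhds E (f p))] with q hq
      exact (g.coord_tangentCoord hq _ _).symm
    rw [this.mvfderiv_eq, mvfderiv_clm_apply ((hd.comp p hdf).clm_apply hYc) hZc,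
      mvfderiv_clm_apply (hd.comp p hdf) hYc, mvfderiv_comp_of_mdifferentiableAt hd hdf]
    rfl
  have h2 : mvfderiv 𝓘(ℝ, E) (fun y ↦ g.val y (FiberBundle.extend E (Y p) y)
        (FiberBundle.extend E (Z p) y)) (f p) w
      = mvfderiv 𝓘(ℝ, E) (g.coord (f p)) (f p) w (tangentCoord (f p) (f p) (Y p))
          (tangentCoord (f p) (f p) (Z p)) := by
    have : (fun y ↦ g.val y (FiberBundle.extend E (Y p) y) (FiberBundle.extend E (Z p) y))
        =ᶠ[nhds (f p)] fun y ↦ g.coord (f p) y (tangentCoord (f p) (f p) (Y p))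
          (tangentCoord (f p) (f p) (Z p)) := by
      filter_upwards [chart_source_mem_nhds E (f p)] with y hy
      rw [← g.coord_tangentCoord hy, extend_eq_tangentOfCoord hy, extend_eq_tangentOfCoord hy,
        tangentCoord_tangentOfCoord hy, tangentCoord_tangentOfCoord hy]
    rw [this.mvfderiv_eq,
      mvfderiv_clm_apply (hd.clm_apply mdifferentiableAt_const) mdifferentiableAt_const,
      mvfderiv_clm_apply hd mdifferentiableAt_const, mvfderiv_const, mvfderiv_const]
    simp
  have h3 := hnab.metric _ _ (f p) w (hm (Y p)) (hm (Z p))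
  rw [h2] at h3
  simp only [FiberBundle.extend_apply_self] at h3
  rw [covAlong_eq nab hf.continuousAt, covAlong_eq nab hf.continuousAt, h1, h3]
  have h4 : ∀ c d : E, g.coord (f p) (f p) c d
      = g.val (f p) (tangentOfCoord (f p) (f p) c) (tangentOfCoord (f p) (f p) d) := fun c d ↦ by
    rw [← g.coord_tangentCoord hx, tangentCoord_tangentOfCoord hx, tangentCoord_tangentOfCoord hx]
  rw [h4, h4, tangentOfCoord_tangentCoord hx, tangentOfCoord_tangentCoord hx]
  simp only [map_add, _root_.add_apply]
  ring

end Along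

/-! ### Torsion along an immersion -/

section Torsion

variable {E : Type*} [NormedAddCommGroup E] [NormedSpace ℝ E]
  {N : Type*} [TopologicalSpace N] [ChartedSpace E N] [IsManifold 𝓘(ℝ, E) ∞ N]

/-- In the chart at `x` both extensions become constant vector fields, whose bracket is zero. -/
theorem mlieBracket_extend (x : N) (u v : TangentSpace 𝓘(ℝ, E) x) :
    VectorField.mlieBracket 𝓘(ℝ, E) (FiberBundle.extend E u) (FiberBundle.extend E v) x = 0 := by
  have : IsManifold 𝓘(ℝ, E) 1 N := IsManifold.of_le (n := ∞) (by simp)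
  have key : ∀ u : TangentSpace 𝓘(ℝ, E) x,
      VectorField.mpullbackWithin 𝓘(ℝ, E) 𝓘(ℝ, E) (extChartAt 𝓘(ℝ, E) x).symm
        (FiberBundle.extend E u) (Set.range 𝓘(ℝ, E))
      =ᶠ[nhds (extChartAt 𝓘(ℝ, E) x x)] fun _ ↦ tangentCoord x x u := by
    intro u
    filter_upwards [extChartAt_target_mem_nhds (I := 𝓘(ℝ, E)) x] with y hy
    have hy' : (extChartAt 𝓘(ℝ, E) x).symm y ∈ (chartAt E x).source := by
      rw [← extChartAt_source 𝓘(ℝ, E)]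
      exact (extChartAt 𝓘(ℝ, E) x).map_target hy
    rw [VectorField.mpullbackWithin_apply, extend_eq_tangentOfCoord hy', tangentOfCoord,
      TangentBundle.symmL_trivializationAt hy', (extChartAt 𝓘(ℝ, E) x).right_inv hy]
    have hinv := isInvertible_mfderivWithin_extChartAt_symm (I := 𝓘(ℝ, E)) hy
    exact hinv.inverse_apply_eq.2 rfl
  rw [← VectorField.mlieBracketWithin_univ, VectorField.mlieBracketWithin_apply,
    (key u).lieBracketWithin_vectorField_eq_nhds (key v)]
  simp only [VectorField.lieBracketWithin, fderivWithin_const_apply, _root_.zero_apply, sub_zero]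
  exact map_zero _

variable [FiniteDimensional ℝ E]
  {F : Type*} [NormedAddCommGroup F] [NormedSpace ℝ F] [FiniteDimensional ℝ F]
  {M : Type*} [TopologicalSpace M] [ChartedSpace F M] [IsManifold 𝓘(ℝ, F) ∞ M]
  {f : M → N} {X Y : ∀ p : M, TangentSpace 𝓘(ℝ, E) (f p)} {p : M}

/-- The pull-back of a torsion-free connection to an immersed submanifold is torsion-free up to
tangent vectors of the submanifold. -/
theorem SemiRiemannianMetric.IsLeviCivita.covAlong_sub_mem_tangentAlong
    {g : SemiRiemannianMetric E N}
    {nab : CovariantDerivative 𝓘(ℝ, E) E (TangentSpace 𝓘(ℝ, E) : N → Type _)}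
    (hnab : g.IsLeviCivita nab) (hf : ContMDiff 𝓘(ℝ, F) 𝓘(ℝ, E) ∞ f)
    (hi : Function.Injective (mfderiv 𝓘(ℝ, F) 𝓘(ℝ, E) f p))
    (hX : SmoothAlongAt F f X p) (hY : SmoothAlongAt F f Y p)
    (hXt : ∀ q, X q ∈ tangentAlong F f q) (hYt : ∀ q, Y q ∈ tangentAlong F f q)
    {u v : TangentSpace 𝓘(ℝ, F) p} (hu : mfderiv 𝓘(ℝ, F) 𝓘(ℝ, E) f p u = X p)
    (hv : mfderiv 𝓘(ℝ, F) 𝓘(ℝ, E) f p v = Y p) :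
    covAlong nab f Y p u - covAlong nab f X p v ∈ tangentAlong F f p := by
  have : IsManifold 𝓘(ℝ, E) 1 N := IsManifold.of_le (n := ∞) (by simp)
  have : IsManifold 𝓘(ℝ, F) 1 M := IsManifold.of_le (n := ∞) (by simp)
  have hm : ∀ u : TangentSpace 𝓘(ℝ, E) (f p), MDifferentiableAt 𝓘(ℝ, E) (𝓘(ℝ, E).prod 𝓘(ℝ, E))
      (fun y ↦ TotalSpace.mk' E y (FiberBundle.extend E u y)) (f p) :=
    FiberBundle.mdifferentiableAt_extend 𝓘(ℝ, E) E
  -- With a vanishing bracket, torsion-freeness makes the connection terms of the two `covAlong`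
  -- expressions equal; only the coordinate derivatives are left to compare.
  have ht := hnab.torsion_free _ _ (f p) (hm (X p)) (hm (Y p))
  rw [mlieBracket_extend] at ht
  simp only [FiberBundle.extend_apply_self] at ht
  rw [covAlong_eq nab (hf p).continuousAt, covAlong_eq nab (hf p).continuousAt, hu, hv]
  set φ := writtenInExtChartAt 𝓘(ℝ, F) 𝓘(ℝ, E) p f with hφ
  set z := extChartAt 𝓘(ℝ, F) p p with hz
  set ψ := extChartAt 𝓘(ℝ, F) p with hψ
  have hψz : ψ.symm z = p := by simp [hψ, hz]
  have hsymm : ContMDiffAt 𝓘(ℝ, F) 𝓘(ℝ, F) ∞ ψ.symm z :=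
    (contMDiffOn_extChartAt_symm p).contMDiffAt (extChartAt_target_mem_nhds p)
  have hφd : ContDiffAt ℝ 2 φ z := by
    have h := ((contMDiffAt_iff ..).1 (hf p)).2
    simp only [modelWithCornersSelf_coe, Set.range_id, contDiffWithinAt_univ] at h
    exact h.of_le (WithTop.coe_le_coe.2 le_top)
  have hdφ : ∀ w : TangentSpace 𝓘(ℝ, F) p,
      mfderiv 𝓘(ℝ, F) 𝓘(ℝ, E) f p w = fderiv ℝ φ z w := by
    intro w
    rw [((hf p).mdifferentiableAt (by simp)).mfderiv]
    simp only [modelWithCornersSelf_coe, Set.range_id, fderivWithin_univ]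
    rfl
  -- Tangency must hold on a neighbourhood in the chart, since the lift in the calculus lemma is
  -- differentiated.
  have hrange : ∀ W : ∀ p : M, TangentSpace 𝓘(ℝ, E) (f p), (∀ q, W q ∈ tangentAlong F f q) →
      ∀ᶠ y in nhds z, tangentCoord (f p) (f (ψ.symm y)) (W (ψ.symm y)) ∈ (fderiv ℝ φ y).range := by
    intro W hW
    have h1 : ∀ᶠ y in nhds z, f (ψ.symm y) ∈ (chartAt E (f p)).source := by
      refine (((hf p).continuousAt.comp_of_eq hsymm.continuousAt hψz)).eventually ?_
      rw [Function.comp_apply, hψz]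
      exact chart_source_mem_nhds E (f p)
    filter_upwards [h1, extChartAt_target_mem_nhds (I := 𝓘(ℝ, F)) p,
      hφd.eventually (by simp)] with y hy hyt hyd
    obtain ⟨w, hw⟩ := hW (ψ.symm y)
    have hys : ψ.symm y ∈ (chartAt F p).source := by
      rw [← extChartAt_source 𝓘(ℝ, F)]
      exact ψ.map_target hyt
    have hfd : MDifferentiableAt 𝓘(ℝ, F) 𝓘(ℝ, E) f (ψ.symm y) := (hf _).mdifferentiableAt (by simp)
    have hed := mdifferentiableAt_extChartAt (I := 𝓘(ℝ, E)) hy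
    have hψd := mdifferentiableAt_extChartAt (I := 𝓘(ℝ, F)) hys
    have hyd' : MDifferentiableAt 𝓘(ℝ, F) 𝓘(ℝ, E) φ (ψ (ψ.symm y)) := by
      rw [ψ.right_inv hyt]
      exact (hyd.differentiableAt (by simp)).mdifferentiableAt
    -- Differentiating this identity at points near `p` expresses the coordinates of df(w) as a
    -- value of dφ.
    have he : extChartAt 𝓘(ℝ, E) (f p) ∘ f =ᶠ[nhds (ψ.symm y)] φ ∘ ψ := by
      filter_upwards [(chartAt F p).open_source.mem_nhds hys] with q hq
      simp only [hφ, writtenInExtChartAt, Function.comp_apply, hψ]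
      rw [(extChartAt 𝓘(ℝ, F) p).left_inv (by rwa [extChartAt_source])]
    rw [tangentCoord, TangentBundle.continuousLinearMapAt_trivializationAt hy, ← hw]
    have h2 := mvfderiv_comp_of_mdifferentiableAt hed hfd w
    have h3 := mvfderiv_comp_of_mdifferentiableAt hyd' hψd w
    have h4 : mvfderiv 𝓘(ℝ, F) φ (ψ (ψ.symm y)) = fderiv ℝ φ y := by
      rw [ψ.right_inv hyt]
      exact (hyd.differentiableAt (by simp)).hasFDerivAt.hasMFDerivAt.mvfderiv_eq
    rw [he.mvfderiv_eq, h3, h4] at h2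
    exact ⟨_, h2⟩
  have hcd : ∀ W : ∀ p : M, TangentSpace 𝓘(ℝ, E) (f p), SmoothAlongAt F f W p →
      DifferentiableAt ℝ (fun y ↦ tangentCoord (f p) (f (ψ.symm y)) (W (ψ.symm y))) z ∧
      ∀ w : TangentSpace 𝓘(ℝ, F) p,
        mvfderiv 𝓘(ℝ, F) (fun q ↦ tangentCoord (f p) (f q) (W q)) p w
        = fderiv ℝ (fun y ↦ tangentCoord (f p) (f (ψ.symm y)) (W (ψ.symm y))) z w := by
    intro W hW
    have h := hW.mdifferentiableAt (hf p)
    have h' := ((mdifferentiableAt_iff ..).1 h).2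
    simp only [modelWithCornersSelf_coe, Set.range_id, differentiableWithinAt_univ] at h'
    refine ⟨h', fun w ↦ ?_⟩
    rw [h.mvfderiv]
    simp only [modelWithCornersSelf_coe, Set.range_id, fderivWithin_univ]
    rfl
  have hco : ∀ w : TangentSpace 𝓘(ℝ, F) p,
      tangentCoord (f p) (f p) (mfderiv 𝓘(ℝ, F) 𝓘(ℝ, E) f p w) = fderiv ℝ φ z w := by
    intro w
    rw [← hdφ, tangentCoord,
      TangentBundle.continuousLinearMapAt_trivializationAt (mem_chart_source E _),
      mfderiv_extChartAt_self]
    rfl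
  have hmem : ∀ (w : TangentSpace 𝓘(ℝ, F) p) (W : ∀ p : M, TangentSpace 𝓘(ℝ, E) (f p)),
      mfderiv 𝓘(ℝ, F) 𝓘(ℝ, E) f p w = W p →
      fderiv ℝ φ z w = tangentCoord (f p) (f (ψ.symm z)) (W (ψ.symm z)) := by
    intro w W hw
    rw [hψz, ← hw, hco]
  obtain ⟨t, ht'⟩ := sub_fderiv_mem_range_of_mem_range hφd
    (fun a b h ↦ hi ((hdφ a).trans (h.trans (hdφ b).symm)))
    (hcd X hX).1 (hcd Y hY).1 (hrange X hXt) (hrange Y hYt) (hmem u X hu) (hmem v Y hv)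
  refine ⟨t, ?_⟩
  have ht'' := (hco t).trans ht'
  rw [← (hcd Y hY).2, ← (hcd X hX).2] at ht''
  have h5 := congrArg (tangentOfCoord (f p) (f p)) ht''
  rw [tangentOfCoord_tangentCoord (mem_chart_source E _), map_sub] at h5
  refine h5.trans ?_
  rw [add_sub_add_comm, ht, add_zero]

end Torsion

/-! ### Global sections through a given vector -/

section Sections

variable {E : Type*} [NormedAddCommGroup E] [NormedSpace ℝ E]
  {N : Type*} [TopologicalSpace N] [ChartedSpace E N] [IsManifold 𝓘(ℝ, E) ∞ N]
  {F : Type*} [NormedAddCommGroup F] [NormedSpace ℝ F]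
  {M : Type*} [TopologicalSpace M] [ChartedSpace F M] {f : M → N}
  {D : ∀ p : M, Submodule ℝ (TangentSpace 𝓘(ℝ, E) (f p))}
  {Y Z : ∀ p : M, TangentSpace 𝓘(ℝ, E) (f p)}

theorem IsSectionOf.add (hf : ContMDiff 𝓘(ℝ, F) 𝓘(ℝ, E) ∞ f) (hY : IsSectionOf F f D Y)
    (hZ : IsSectionOf F f D Z) : IsSectionOf F f D (fun q ↦ Y q + Z q) :=
  ⟨fun p ↦ (hY.1 p).add (hf p) (hZ.1 p), fun p ↦ add_mem (hY.2 p) (hZ.2 p)⟩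

/-- Extend with constant coefficients in a local frame and cut off by a bump function supported in
the frame's domain. This lets pointwise conditions be tested on global sections. -/
theorem IsSubbundleAlong.exists_isSectionOf [FiniteDimensional ℝ F] [T2Space M]
    [IsManifold 𝓘(ℝ, F) ∞ M] (hf : ContMDiff 𝓘(ℝ, F) 𝓘(ℝ, E) ∞ f)
    (hD : IsSubbundleAlong F f D) {p : M} {v : TangentSpace 𝓘(ℝ, E) (f p)} (hv : v ∈ D p) :
    ∃ Y, IsSectionOf F f D Y ∧ Y p = v := by
  obtain ⟨k, e, U, hU, hpU, he, hspan⟩ := hD p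
  rw [← (hspan p hpU).2, Submodule.mem_span_range_iff_exists_fun] at hv
  obtain ⟨c, hc⟩ := hv
  obtain ⟨ρ, -, hρ⟩ := (SmoothBumpFunction.nhds_basis_tsupport (I := 𝓘(ℝ, F)) p).mem_iff.1
    (hU.mem_nhds hpU)
  refine ⟨fun q ↦ ρ q • ∑ i, c i • e i q, ⟨fun q ↦ ?_, fun q ↦ ?_⟩, by simp [hc]⟩
  · by_cases hq : q ∈ U
    · exact SmoothAlongAt.smul (hf q) (ρ.contMDiff q) (SmoothAlongAt.sum (hf q) _ fun i _ ↦
        SmoothAlongAt.smul (hf q) contMDiffAt_const (he i q hq))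
    · rw [smoothAlongAt_iff (hf q)]
      refine (contMDiffAt_const (c := (0 : E))).congr_of_eventuallyEq ?_
      have : (tsupport ρ)ᶜ ∈ nhds q :=
        (isClosed_tsupport _).isOpen_compl.mem_nhds fun h ↦ hq (hρ h)
      filter_upwards [this] with y hy
      simp [image_eq_zero_of_notMem_tsupport hy]
  · by_cases hq : q ∈ U
    · rw [← (hspan q hq).2]
      exact Submodule.smul_mem _ _ (Submodule.sum_mem _ fun i _ ↦
        Submodule.smul_mem _ _ (Submodule.subset_span ⟨i, rfl⟩))
    · simp [image_eq_zero_of_notMem_tsupport fun h ↦ hq (hρ h)]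

end Sections

/-! ### Orthogonality relations of a lightlike submanifold -/

namespace LightlikeSubmanifold

variable {E : Type*} [NormedAddCommGroup E] [NormedSpace ℝ E]
  {N : Type*} [TopologicalSpace N] [ChartedSpace E N] [IsManifold 𝓘(ℝ, E) ∞ N]
  {g : SemiRiemannianMetric E N}
  {F : Type*} [NormedAddCommGroup F] [NormedSpace ℝ F]
  {M : Type*} [TopologicalSpace M] [ChartedSpace F M] [IsManifold 𝓘(ℝ, F) ∞ M]
  (L : LightlikeSubmanifold g F M) {p : M} {u v w : TangentSpace 𝓘(ℝ, E) (L.f p)}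

theorem scr_le_tangent (p : M) : L.scr p ≤ tangentAlong F L.f p :=
  (L.tangent_eq p).1 ▸ le_sup_left

theorem coscr_le_normal (p : M) : L.coscr p ≤ normalAlong F g L.f p :=
  (L.normal_eq p).1 ▸ le_sup_left

theorem val_tangent_normal (hu : u ∈ tangentAlong F L.f p) (hv : v ∈ normalAlong F g L.f p) :
    g.val (L.f p) u v = 0 := hv u hu

theorem val_scr_ltr (hu : u ∈ L.scr p) (hv : v ∈ L.ltr p) : g.val (L.f p) u v = 0 := by
  have h : v ∈ (g.bilin (L.f p)).orthogonal (L.scr p ⊔ L.coscr p) :=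
    (L.ltr_compl p).1 ▸ Submodule.mem_sup_left hv
  exact h u (Submodule.mem_sup_left hu)

theorem val_coscr_ltr (hu : u ∈ L.coscr p) (hv : v ∈ L.ltr p) : g.val (L.f p) u v = 0 := by
  have h : v ∈ (g.bilin (L.f p)).orthogonal (L.scr p ⊔ L.coscr p) :=
    (L.ltr_compl p).1 ▸ Submodule.mem_sup_left hv
  exact h u (Submodule.mem_sup_right hu)

theorem val_scr_tr (hu : u ∈ L.scr p) (hv : v ∈ L.tr p) : g.val (L.f p) u v = 0 := by
  obtain ⟨l, hl, c, hc, rfl⟩ := Submodule.mem_sup.1 hv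
  rw [map_add, L.val_scr_ltr hu hl,
    L.val_tangent_normal (L.scr_le_tangent p hu) (L.coscr_le_normal p hc), add_zero]

theorem val_ltr_tr (hu : u ∈ L.ltr p) (hv : v ∈ L.tr p) : g.val (L.f p) u v = 0 := by
  obtain ⟨l, hl, c, hc, rfl⟩ := Submodule.mem_sup.1 hv
  rw [map_add, L.ltr_isotropic p u hu l hl, g.symm, L.val_coscr_ltr hc hu, add_zero]

theorem mfderiv_tangentLift (hu : u ∈ tangentAlong F L.f p) :
    mfderiv 𝓘(ℝ, F) 𝓘(ℝ, E) L.f p (L.tangentLift p u) = u :=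
  Function.invFun_eq hu

theorem tangentLift_add (hu : u ∈ tangentAlong F L.f p) (hv : v ∈ tangentAlong F L.f p) :
    L.tangentLift p (u + v) = L.tangentLift p u + L.tangentLift p v := by
  apply L.immersion p
  rw [map_add, L.mfderiv_tangentLift hu, L.mfderiv_tangentLift hv,
    L.mfderiv_tangentLift (add_mem hu hv)]

theorem tangentLift_neg (hu : u ∈ tangentAlong F L.f p) :
    L.tangentLift p (-u) = -L.tangentLift p u := by
  apply L.immersion p
  rw [map_neg, L.mfderiv_tangentLift hu, L.mfderiv_tangentLift (neg_mem hu)]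

variable [FiniteDimensional ℝ E]

theorem exists_tr_eq_add (p : M) (u : TangentSpace 𝓘(ℝ, E) (L.f p)) :
    ∃ t ∈ L.tr p, u = L.tangentialPart p u + t :=
  ⟨u - L.tangentialPart p u, Submodule.sub_projection_mem _ u, by abel⟩

theorem tangentialPart_add_tr (hu : u ∈ tangentAlong F L.f p) (hv : v ∈ L.tr p) :
    L.tangentialPart p (u + v) = u := by
  rw [tangentialPart, map_add, Submodule.projection_apply_of_mem_left _ hu,
    (Submodule.projection_apply_eq_zero_iff _).2 hv, add_zero]

end LightlikeSubmanifold

namespace IndefiniteKahlerManifold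

variable {E : Type*} [NormedAddCommGroup E] [NormedSpace ℝ E] [FiniteDimensional ℝ E]
  {N : Type*} [TopologicalSpace N] [ChartedSpace E N] [IsManifold 𝓘(ℝ, E) ∞ N]
  (K : IndefiniteKahlerManifold E N)

theorem val_J_left (x : N) (u v : TangentSpace 𝓘(ℝ, E) x) :
    K.g.val x (K.J x u) v = -K.g.val x u (K.J x v) := by
  rw [← K.hermitian x u, K.J_sq, map_neg, neg_neg]

end IndefiniteKahlerManifold

/-! ### Pointwise algebra of the STCR decomposition -/

namespace STCRStructure

variable {E : Type*} [NormedAddCommGroup E] [NormedSpace ℝ E] [FiniteDimensional ℝ E]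
  {N : Type*} [TopologicalSpace N] [ChartedSpace E N] [IsManifold 𝓘(ℝ, E) ∞ N]
  {K : IndefiniteKahlerManifold E N}
  {F : Type*} [NormedAddCommGroup F] [NormedSpace ℝ F]
  {M : Type*} [TopologicalSpace M] [ChartedSpace F M] [IsManifold 𝓘(ℝ, F) ∞ M]
  {L : LightlikeSubmanifold K.g F M} (Q : STCRStructure K L)
  {p : M} {u v w a : TangentSpace 𝓘(ℝ, E) (L.f p)}

section Pointwise

theorem D₀_le_scr (p : M) : Q.D₀ p ≤ L.scr p := (Q.scr_eq p).1 ▸ le_sup_right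

theorem D₀_le_tangent (p : M) : Q.D₀ p ≤ tangentAlong F L.f p :=
  (Q.D₀_le_scr p).trans (L.scr_le_tangent p)

theorem D'_le_scr (p : M) : Q.D' p ≤ L.scr p :=
  (Q.scr_eq p).1 ▸ le_sup_right.trans le_sup_left

theorem D₁_le_rad (p : M) : Q.D₁ p ≤ radAlong F K.g L.f p := (Q.rad_eq p).1 ▸ le_sup_left

theorem J_mem_D₀ (hu : u ∈ Q.D₀ p) : K.J (L.f p) u ∈ Q.D₀ p := by
  have h := Submodule.mem_map_of_mem (f := (K.J (L.f p)).toLinearMap) hu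
  rwa [Q.J_D₀] at h

theorem exists_J_D'_eq (hv : v ∈ Q.L₁ p) : ∃ d ∈ Q.D' p, K.J (L.f p) d = v := by
  have h : v ∈ (Q.D' p).map (K.J (L.f p)).toLinearMap :=
    (Q.J_D' p).1 ▸ Submodule.mem_sup_left hv
  exact h

theorem val_D₀_rest (hu : u ∈ Q.D₀ p) (hv : v ∈ Q.rest p) : K.g.val (L.f p) u v = 0 := by
  obtain ⟨c, hc, t, ht, rfl⟩ := Submodule.mem_sup.1 hv
  obtain ⟨s, hs, r, hr, rfl⟩ := Submodule.mem_sup.1 hc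
  rw [map_add, map_add, K.g.symm, Q.scr_orthogonal p s hs u hu,
    L.val_tangent_normal (Q.D₀_le_tangent p hu) hr.2, L.val_scr_tr (Q.D₀_le_scr p hu) ht,
    add_zero, add_zero]

/-- The complement `rest` is orthogonal to `D₀`, so pairing with `D₀` sees only the `D₀`-component,
and nondegeneracy of `D₀` detects it. -/
theorem D₀Component_eq_zero_iff :
    Q.D₀Component p u = 0 ↔ ∀ y ∈ Q.D₀ p, K.g.val (L.f p) u y = 0 := by
  have hr : u - Q.D₀Component p u ∈ Q.rest p := Submodule.sub_projection_mem _ u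
  have h : ∀ y ∈ Q.D₀ p, K.g.val (L.f p) u y = K.g.val (L.f p) (Q.D₀Component p u) y := by
    intro y hy
    have := Q.val_D₀_rest hy hr
    rw [map_sub, sub_eq_zero] at this
    rw [K.g.symm, this, K.g.symm]
  constructor
  · intro h0 y hy
    rw [h y hy, h0]
    simp
  · intro h0
    exact Q.D₀_nondegenerate p _ (Submodule.projection_apply_mem _ u) fun y hy ↦ by
      rw [← h y hy, h0 y hy]

/-- `L₁` separates the vectors of `D₁`. -/
theorem eq_zero_of_mem_D₁ (ha : a ∈ Q.D₁ p) (h : ∀ v ∈ Q.L₁ p, K.g.val (L.f p) v a = 0) :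
    a = 0 := by
  have hrad := Q.D₁_le_rad p ha
  have hJa : K.J (L.f p) a ∈ L.scr p := Q.J_D₁ p ⟨a, ha, rfl⟩
  -- J `a` is orthogonal to each piece of the screen. The hypothesis on `L₁` enters for `D'`,
  -- through J `D'` = `L₁` ⊥ `S`.
  have hscr : ∀ s ∈ L.scr p, K.g.val (L.f p) (K.J (L.f p) a) s = 0 := by
    intro s hs
    rw [← (Q.scr_eq p).1] at hs
    obtain ⟨c, hc, d, hd, rfl⟩ := Submodule.mem_sup.1 hs
    obtain ⟨_, ⟨b, hb, rfl⟩, d', hd', rfl⟩ := Submodule.mem_sup.1 hc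
    have h1 : K.g.val (L.f p) (K.J (L.f p) a) (K.J (L.f p) b) = 0 := by
      rw [K.hermitian]
      exact L.val_tangent_normal hrad.1 (Q.D₁_le_rad p hb).2
    have h2 : K.g.val (L.f p) (K.J (L.f p) a) d' = 0 := by
      have hm : K.J (L.f p) d' ∈ (Q.D' p).map (K.J (L.f p)).toLinearMap := ⟨d', hd', rfl⟩
      rw [← (Q.J_D' p).1] at hm
      obtain ⟨l, hl, c, hc, hlc⟩ := Submodule.mem_sup.1 hm
      rw [K.val_J_left, ← hlc, map_add, K.g.symm _ _ l, h l hl,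
        L.val_tangent_normal hrad.1 (L.coscr_le_normal p (Q.S_le p hc))]
      simp
    have h3 : K.g.val (L.f p) (K.J (L.f p) a) d = 0 :=
      Q.scr_orthogonal p _ (Submodule.mem_sup_left ⟨a, ha, rfl⟩) d hd
    rw [map_add, map_add, h3, h2, add_zero, add_zero]
    exact h1
  -- As a screen vector J `a` is also orthogonal to Rad(TM) and tr(TM), hence to everything.
  have h0 : K.J (L.f p) a = 0 := by
    refine K.g.nondegenerate _ _ fun v ↦ ?_
    obtain ⟨t, ht, hvt⟩ := L.exists_tr_eq_add p v
    have hT : L.tangentialPart p v ∈ tangentAlong F L.f p := Submodule.projection_apply_mem _ v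
    rw [← (L.tangent_eq p).1] at hT
    obtain ⟨s, hs, r, hr, hsr⟩ := Submodule.mem_sup.1 hT
    rw [hvt, ← hsr, map_add, map_add, hscr s hs,
      L.val_tangent_normal (L.scr_le_tangent p hJa) hr.2, L.val_scr_tr hJa ht, add_zero, add_zero]
  have := K.J_sq _ a
  rw [h0, map_zero] at this
  exact neg_eq_zero.1 this.symm

/-- Moving J across the pairing turns it into one of `D'` with J `D₂`, that is, of a tangent with a
normal vector. -/
theorem val_L₁_D₂ (hv : v ∈ Q.L₁ p) (hu : u ∈ Q.D₂ p) : K.g.val (L.f p) v u = 0 := by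
  obtain ⟨d, hd, rfl⟩ := Q.exists_J_D'_eq hv
  have hJu : K.J (L.f p) u ∈ L.coscr p := Q.J_D₂ p ⟨u, hu, rfl⟩
  rw [K.val_J_left, L.val_tangent_normal (L.scr_le_tangent p (Q.D'_le_scr p hd))
    (L.coscr_le_normal p hJu), neg_zero]

/-- If the tangential part of `w` lies in `D₀`, then `L₁` is orthogonal to `w` and to `J w`. -/
theorem val_L₁_eq_zero_of_tangentialPart_mem (hw : L.tangentialPart p w ∈ Q.D₀ p)
    (hv : v ∈ Q.L₁ p) :
    K.g.val (L.f p) v w = 0 ∧ K.g.val (L.f p) v (K.J (L.f p) w) = 0 := by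
  obtain ⟨t, ht, hwt⟩ := L.exists_tr_eq_add p w
  have hltr := Q.L₁_le p hv
  constructor
  · rw [hwt, map_add, K.g.symm, L.val_scr_ltr (Q.D₀_le_scr p hw) hltr, L.val_ltr_tr hltr ht,
      add_zero]
  · obtain ⟨d, hd, rfl⟩ := Q.exists_J_D'_eq hv
    rw [K.hermitian, hwt, map_add, L.val_scr_tr (Q.D'_le_scr p hd) ht,
      Q.scr_orthogonal p d (Submodule.mem_sup_right hd) _ hw, add_zero]

/-- If `L₁` is orthogonal to a tangent vector `u` and to `J u`, then the tangential part of `J u`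
lies in `D₀`. -/
theorem tangentialPart_J_mem_D₀ (hu : u ∈ tangentAlong F L.f p)
    (h₁ : ∀ v ∈ Q.L₁ p, K.g.val (L.f p) v u = 0)
    (h₂ : ∀ v ∈ Q.L₁ p, K.g.val (L.f p) v (K.J (L.f p) u) = 0) :
    L.tangentialPart p (K.J (L.f p) u) ∈ Q.D₀ p := by
  rw [← (L.tangent_eq p).1, ← (Q.scr_eq p).1, ← (Q.rad_eq p).1] at hu
  obtain ⟨s, hs, r, hr, rfl⟩ := Submodule.mem_sup.1 hu
  obtain ⟨c, hc, d, hd, rfl⟩ := Submodule.mem_sup.1 hs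
  obtain ⟨_, ⟨b, hb, rfl⟩, d', hd', rfl⟩ := Submodule.mem_sup.1 hc
  obtain ⟨e₁, he₁, e₂, he₂, rfl⟩ := Submodule.mem_sup.1 hr
  have hb' : K.J (L.f p) b ∈ L.scr p := Q.J_D₁ p ⟨b, hb, rfl⟩
  have hJd := Q.J_mem_D₀ hd
  have hltr : ∀ v ∈ Q.L₁ p, ∀ s ∈ L.scr p, K.g.val (L.f p) v s = 0 := fun v hv s hs ↦ by
    rw [K.g.symm]
    exact L.val_scr_ltr hs (Q.L₁_le p hv)
  have htr : K.J (L.f p) d' ∈ L.tr p := by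
    have hm : K.J (L.f p) d' ∈ (Q.D' p).map (K.J (L.f p)).toLinearMap := ⟨d', hd', rfl⟩
    rw [← (Q.J_D' p).1] at hm
    exact (sup_le_sup (Q.L₁_le p) (Q.S_le p)) hm
  have htr₂ : K.J (L.f p) e₂ ∈ L.tr p := Submodule.mem_sup_right (Q.J_D₂ p ⟨e₂, he₂, rfl⟩)
  -- All other components of `u` are orthogonal to `L₁`, so the first hypothesis is a condition on
  -- the `D₁`-component alone.
  have he₁0 : e₁ = 0 := by
    refine Q.eq_zero_of_mem_D₁ he₁ fun v hv ↦ ?_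
    have h := h₁ v hv
    simp only [map_add] at h
    rw [hltr v hv d' (Q.D'_le_scr p hd'), hltr v hv d (Q.D₀_le_scr p hd), Q.val_L₁_D₂ hv he₂] at h
    have h' : K.g.val (L.f p) v (K.J (L.f p) b) = 0 := hltr v hv _ hb'
    simpa [h'] using h
  subst he₁0
  -- With `e₁` gone, the only component of Ju that `L₁` can see is J²b = −b.
  have hb0 : b = 0 := by
    refine Q.eq_zero_of_mem_D₁ hb fun v hv ↦ ?_
    have h := h₂ v hv
    simp only [map_add, map_zero] at h
    rw [hltr v hv _ (Q.D₀_le_scr p hJd), L.val_ltr_tr (Q.L₁_le p hv) htr,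
      L.val_ltr_tr (Q.L₁_le p hv) htr₂] at h
    have h' : K.g.val (L.f p) v (K.J (L.f p) ((K.J (L.f p)).toLinearMap b))
        = -K.g.val (L.f p) v b := by
      change K.g.val (L.f p) v (K.J (L.f p) (K.J (L.f p) b)) = _
      rw [K.J_sq, map_neg]
    rw [h'] at h
    simpa only [add_zero, neg_eq_zero] using h
  subst hb0
  have : K.J (L.f p) ((K.J (L.f p)).toLinearMap 0 + d' + d + (0 + e₂))
      = K.J (L.f p) d + (K.J (L.f p) d' + K.J (L.f p) e₂) := by
    simp only [map_add, map_zero]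
    abel
  rw [this, L.tangentialPart_add_tr (Q.D₀_le_tangent p hJd) (add_mem htr htr₂)]
  exact hJd

end Pointwise

end STCRStructure

/-! ### Ambient derivatives and shape operators -/

namespace LightlikeSubmanifold

variable {E : Type*} [NormedAddCommGroup E] [NormedSpace ℝ E]
  {N : Type*} [TopologicalSpace N] [ChartedSpace E N] [IsManifold 𝓘(ℝ, E) ∞ N]
  {g : SemiRiemannianMetric E N}
  {F : Type*} [NormedAddCommGroup F] [NormedSpace ℝ F]
  {M : Type*} [TopologicalSpace M] [ChartedSpace F M] [IsManifold 𝓘(ℝ, F) ∞ M]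
  (L : LightlikeSubmanifold g F M) {p : M}
  (nab : CovariantDerivative 𝓘(ℝ, E) E (TangentSpace 𝓘(ℝ, E) : N → Type _))
  {X X' Y Y' : ∀ p : M, TangentSpace 𝓘(ℝ, E) (L.f p)}

theorem ambientDeriv_add_left (hX : X p ∈ tangentAlong F L.f p)
    (hX' : X' p ∈ tangentAlong F L.f p) :
    L.ambientDeriv nab (fun q ↦ X q + X' q) Y p
      = L.ambientDeriv nab X Y p + L.ambientDeriv nab X' Y p := by
  simp only [ambientDeriv, L.tangentLift_add hX hX']
  exact covAlong_add_dir nab (L.smooth p).continuousAt _ _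

theorem ambientDeriv_neg_left (hX : X p ∈ tangentAlong F L.f p) :
    L.ambientDeriv nab (fun q ↦ -X q) Y p = -L.ambientDeriv nab X Y p := by
  simp only [ambientDeriv, L.tangentLift_neg hX]
  rw [eq_neg_iff_add_eq_zero, ← covAlong_add_dir nab (L.smooth p).continuousAt, neg_add_cancel,
    covAlong_eq nab (L.smooth p).continuousAt]
  simp

theorem ambientDeriv_add_right (hY : SmoothAlongAt F L.f Y p) (hY' : SmoothAlongAt F L.f Y' p) :
    L.ambientDeriv nab X (fun q ↦ Y q + Y' q) p
      = L.ambientDeriv nab X Y p + L.ambientDeriv nab X Y' p :=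
  covAlong_add nab (L.smooth p) hY hY' _

variable [FiniteDimensional ℝ E]

theorem ambientDeriv_sub_mem_tangentAlong [FiniteDimensional ℝ F] {nab} (hnab : g.IsLeviCivita nab)
    (hX : ∀ q, SmoothAlongAt F L.f X q) (hXt : ∀ q, X q ∈ tangentAlong F L.f q)
    (hY : ∀ q, SmoothAlongAt F L.f Y q) (hYt : ∀ q, Y q ∈ tangentAlong F L.f q) :
    L.ambientDeriv nab X Y p - L.ambientDeriv nab Y X p ∈ tangentAlong F L.f p :=
  hnab.covAlong_sub_mem_tangentAlong L.smooth (L.immersion p) (hX p) (hY p) hXt hYt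
    (L.mfderiv_tangentLift (hXt p)) (L.mfderiv_tangentLift (hYt p))

/-- `A_V X` and the ambient derivative are dual to each other on sections orthogonal to `V`. -/
theorem val_shapeOperator {nab} (hnab : g.IsLeviCivita nab)
    (hV : SmoothAlongAt F L.f X' p) (hY : SmoothAlongAt F L.f Y p) (hYs : Y p ∈ L.scr p)
    (h0 : ∀ q, g.val (L.f q) (X' q) (Y q) = 0) :
    g.val (L.f p) (L.shapeOperator nab X' X p) (Y p)
      = g.val (L.f p) (X' p) (L.ambientDeriv nab X Y p) := by
  -- Differentiate the identity g(V, Y) = 0 in the direction of X; here `X'` plays the role of V.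
  have h := hnab.mvfderiv_along (L.smooth p) hV hY (L.tangentLift p (X p))
  simp only [h0] at h
  rw [mvfderiv_const] at h
  obtain ⟨t, ht, hvt⟩ := L.exists_tr_eq_add p (L.ambientDeriv nab X X' p)
  -- `Y p` lies in the screen, which is orthogonal to tr(TM), so the transversal part drops out.
  have h1 : g.val (L.f p) (L.ambientDeriv nab X X' p) (Y p)
      = g.val (L.f p) (L.tangentialPart p (L.ambientDeriv nab X X' p)) (Y p) := by
    conv_lhs => rw [hvt]
    rw [g.symm, map_add, L.val_scr_tr hYs ht, add_zero, g.symm]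
  have h2 : (0 : ℝ) = g.val (L.f p) (L.ambientDeriv nab X X' p) (Y p)
      + g.val (L.f p) (X' p) (L.ambientDeriv nab X Y p) := h
  simp only [shapeOperator, map_neg, _root_.neg_apply]
  linarith

end LightlikeSubmanifold

/-! ### The operator `dbar` and the equivalence -/

namespace STCRStructure

variable {E : Type*} [NormedAddCommGroup E] [NormedSpace ℝ E] [FiniteDimensional ℝ E]
  {N : Type*} [TopologicalSpace N] [ChartedSpace E N] [IsManifold 𝓘(ℝ, E) ∞ N]
  {K : IndefiniteKahlerManifold E N}
  {F : Type*} [NormedAddCommGroup F] [NormedSpace ℝ F]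
  {M : Type*} [TopologicalSpace M] [ChartedSpace F M] [IsManifold 𝓘(ℝ, F) ∞ M]
  {L : LightlikeSubmanifold K.g F M} (Q : STCRStructure K L)
  {p : M} {v : TangentSpace 𝓘(ℝ, E) (L.f p)}
  {X X' Y Y' V : ∀ p : M, TangentSpace 𝓘(ℝ, E) (L.f p)}

theorem isSectionOf_applyJ (hX : IsSectionOf F L.f Q.D₀ X) :
    IsSectionOf F L.f Q.D₀ (Q.applyJ X) :=
  ⟨fun p ↦ SmoothAlongAt.end_apply K.J_smooth (L.smooth p) (hX.1 p), fun p ↦ Q.J_mem_D₀ (hX.2 p)⟩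

theorem applyJ_applyJ : Q.applyJ (Q.applyJ X) = fun q ↦ -X q :=
  funext fun q ↦ K.J_sq (L.f q) (X q)

theorem ambientDeriv_applyJ (hY : IsSectionOf F L.f Q.D₀ Y) (p : M) :
    L.ambientDeriv K.nab X (Q.applyJ Y) p = K.J (L.f p) (L.ambientDeriv K.nab X Y p) :=
  covAlong_end_apply K.nab K.J_smooth K.J_parallel (L.smooth p) (hY.1 p) _

/-- The Cauchy-Riemann type operator `∇_{JX} Y - J ∇_X Y` of the ambient connection. -/
def dbar (X Y : ∀ p : M, TangentSpace 𝓘(ℝ, E) (L.f p)) (p : M) : TangentSpace 𝓘(ℝ, E) (L.f p) :=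
  L.ambientDeriv K.nab (Q.applyJ X) Y p - K.J (L.f p) (L.ambientDeriv K.nab X Y p)

theorem dbar_applyJ_right (hY : IsSectionOf F L.f Q.D₀ Y) :
    Q.dbar X (Q.applyJ Y) p = K.J (L.f p) (Q.dbar X Y p) := by
  simp only [dbar, Q.ambientDeriv_applyJ hY, map_sub]

theorem dbar_applyJ_left (hX : IsSectionOf F L.f Q.D₀ X) :
    Q.dbar (Q.applyJ X) Y p = -K.J (L.f p) (Q.dbar X Y p) := by
  simp only [dbar, Q.applyJ_applyJ, map_sub, K.J_sq,
    L.ambientDeriv_neg_left K.nab (Q.D₀_le_tangent p (hX.2 p))]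
  abel

theorem dbar_add_left (hX : IsSectionOf F L.f Q.D₀ X) (hX' : IsSectionOf F L.f Q.D₀ X') :
    Q.dbar (fun q ↦ X q + X' q) Y p = Q.dbar X Y p + Q.dbar X' Y p := by
  have h : Q.applyJ (fun q ↦ X q + X' q) = fun q ↦ Q.applyJ X q + Q.applyJ X' q :=
    funext fun q ↦ map_add (K.J (L.f q)) _ _
  have hT : ∀ {Z : ∀ p : M, TangentSpace 𝓘(ℝ, E) (L.f p)}, IsSectionOf F L.f Q.D₀ Z →
    Z p ∈ tangentAlong F L.f p := fun hZ ↦ Q.D₀_le_tangent p (hZ.2 p)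
  simp only [dbar, h]
  rw [L.ambientDeriv_add_left K.nab (hT hX) (hT hX'), L.ambientDeriv_add_left K.nab
    (hT (Q.isSectionOf_applyJ hX)) (hT (Q.isSectionOf_applyJ hX')), map_add]
  abel

theorem dbar_add_right (hY : IsSectionOf F L.f Q.D₀ Y) (hY' : IsSectionOf F L.f Q.D₀ Y') :
    Q.dbar X (fun q ↦ Y q + Y' q) p = Q.dbar X Y p + Q.dbar X Y' p := by
  simp only [dbar, L.ambientDeriv_add_right K.nab (hY.1 p) (hY'.1 p), map_add]
  abel

/-- J commutes with the derivative, so ∇̄_X X + ∇̄_{JX} JX = ∇̄_X X + J ∇̄_{JX} X, and J can be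
factored out. -/
theorem inducedDeriv_add_inducedDeriv (hX : IsSectionOf F L.f Q.D₀ X) (p : M) :
    L.inducedDeriv K.nab X X p + L.inducedDeriv K.nab (Q.applyJ X) (Q.applyJ X) p
      = L.tangentialPart p (K.J (L.f p) (Q.dbar X X p)) := by
  rw [LightlikeSubmanifold.inducedDeriv, LightlikeSubmanifold.inducedDeriv, ← map_add,
    Q.ambientDeriv_applyJ hX, dbar, map_sub, K.J_sq]
  congr 1
  abel

/-- Parallelism of J rewrites `dbar X X` as ∇̄_{JX} X − ∇̄_X JX, a torsion-type difference of two
tangent fields. -/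
theorem dbar_self_mem_tangentAlong [FiniteDimensional ℝ F] (hX : IsSectionOf F L.f Q.D₀ X)
    (p : M) : Q.dbar X X p ∈ tangentAlong F L.f p := by
  rw [dbar, ← Q.ambientDeriv_applyJ hX]
  exact L.ambientDeriv_sub_mem_tangentAlong K.leviCivita (Q.isSectionOf_applyJ hX).1
    (fun q ↦ Q.D₀_le_tangent q ((Q.isSectionOf_applyJ hX).2 q)) hX.1
    (fun q ↦ Q.D₀_le_tangent q (hX.2 q))

/-- Duality of A_V with the ambient derivative is used twice, on `Y` and on J`Y`; skewness of J and
its parallelism put the second term in the form required by `dbar`. -/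
theorem val_shapeOperator_add (hV : IsSectionOf F L.f Q.L₁ V) (hY : IsSectionOf F L.f Q.D₀ Y)
    (p : M) :
    K.g.val (L.f p) (L.shapeOperator K.nab V (Q.applyJ X) p
        + K.J (L.f p) (L.shapeOperator K.nab V X p)) (Y p)
      = K.g.val (L.f p) (V p) (Q.dbar X Y p) := by
  have h0 : ∀ {Z : ∀ p : M, TangentSpace 𝓘(ℝ, E) (L.f p)}, IsSectionOf F L.f Q.D₀ Z →
      ∀ q, K.g.val (L.f q) (V q) (Z q) = 0 := fun hZ q ↦ by
    rw [K.g.symm]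
    exact L.val_scr_ltr (Q.D₀_le_scr q (hZ.2 q)) (Q.L₁_le q (hV.2 q))
  have hJY := Q.isSectionOf_applyJ hY
  have h1 := L.val_shapeOperator (X := Q.applyJ X) K.leviCivita (hV.1 p) (hY.1 p)
    (Q.D₀_le_scr p (hY.2 p)) (h0 hY)
  have h2 := L.val_shapeOperator (X := X) K.leviCivita (hV.1 p) (hJY.1 p)
    (Q.D₀_le_scr p (hJY.2 p)) (h0 hJY)
  rw [Q.ambientDeriv_applyJ hY] at h2
  rw [map_add, _root_.add_apply, h1, K.val_J_left, dbar, map_sub, ← h2, sub_eq_add_neg]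
  rfl

/-- If the quadratic form of `g(v, dbar X Y)` and that of `g(v, J dbar X Y)` vanish, then so does
`g(v, dbar X Y)`. -/
theorem val_dbar_eq_zero
    (h₁ : ∀ X, IsSectionOf F L.f Q.D₀ X → K.g.val (L.f p) v (Q.dbar X X p) = 0)
    (h₂ : ∀ X, IsSectionOf F L.f Q.D₀ X →
      K.g.val (L.f p) v (K.J (L.f p) (Q.dbar X X p)) = 0)
    (hX : IsSectionOf F L.f Q.D₀ X) (hY : IsSectionOf F L.f Q.D₀ Y) :
    K.g.val (L.f p) v (Q.dbar X Y p) = 0 := by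
  have polar : ∀ {X Y : ∀ p : M, TangentSpace 𝓘(ℝ, E) (L.f p)}, IsSectionOf F L.f Q.D₀ X →
      IsSectionOf F L.f Q.D₀ Y → Q.dbar (fun q ↦ X q + Y q) (fun q ↦ X q + Y q) p
        = Q.dbar X X p + Q.dbar X Y p + (Q.dbar Y X p + Q.dbar Y Y p) := fun hX hY ↦ by
    rw [Q.dbar_add_left hX hY, Q.dbar_add_right hX hY, Q.dbar_add_right hX hY]
  -- Polarization: a biadditive form vanishing on the diagonal is skew.
  have a₁ : ∀ {X Y : ∀ p : M, TangentSpace 𝓘(ℝ, E) (L.f p)}, IsSectionOf F L.f Q.D₀ X →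
      IsSectionOf F L.f Q.D₀ Y →
      K.g.val (L.f p) v (Q.dbar X Y p) = -K.g.val (L.f p) v (Q.dbar Y X p) := fun hX hY ↦ by
    have h := h₁ _ (hX.add L.smooth hY)
    rw [polar hX hY, map_add, map_add, map_add, h₁ _ hX, h₁ _ hY] at h
    linarith
  have a₂ : ∀ {X Y : ∀ p : M, TangentSpace 𝓘(ℝ, E) (L.f p)}, IsSectionOf F L.f Q.D₀ X →
      IsSectionOf F L.f Q.D₀ Y → K.g.val (L.f p) v (K.J (L.f p) (Q.dbar X Y p))
        = -K.g.val (L.f p) v (K.J (L.f p) (Q.dbar Y X p)) := fun hX hY ↦ by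
    have h := h₂ _ (hX.add L.smooth hY)
    simp only [polar hX hY, map_add, h₂ _ hX, h₂ _ hY] at h
    linarith
  -- Applying the first skewness to `X` and J`Y`, with J-linearity on one side and J-antilinearity
  -- on the other, shows that g(v, J `dbar X Y`) is symmetric. It is also skew, hence zero.
  have hz : ∀ {X Y : ∀ p : M, TangentSpace 𝓘(ℝ, E) (L.f p)}, IsSectionOf F L.f Q.D₀ X →
      IsSectionOf F L.f Q.D₀ Y →
      K.g.val (L.f p) v (K.J (L.f p) (Q.dbar X Y p)) = 0 := fun hX hY ↦ by
    have h := a₁ hX (Q.isSectionOf_applyJ hY)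
    rw [Q.dbar_applyJ_right hY, Q.dbar_applyJ_left hY, map_neg, neg_neg] at h
    have h' := a₂ hX hY
    linarith
  -- Replacing `Y` by J`Y` brings in J² = −1 and removes the J.
  have h := hz hX (Q.isSectionOf_applyJ hY)
  rwa [Q.dbar_applyJ_right hY, K.J_sq, map_neg, neg_eq_zero] at h

end STCRStructure
end

theorem theorem5p2
    {E : Type*} [NormedAddCommGroup E] [NormedSpace ℝ E] [FiniteDimensional ℝ E]
    {N : Type*} [TopologicalSpace N] [T2Space N] [ChartedSpace E N] [IsManifold 𝓘(ℝ, E) ∞ N]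
    (K : IndefiniteKahlerManifold E N)
    {F : Type*} [NormedAddCommGroup F] [NormedSpace ℝ F] [FiniteDimensional ℝ F]
    {M : Type*} [TopologicalSpace M] [T2Space M] [ChartedSpace F M] [IsManifold 𝓘(ℝ, F) ∞ M]
    (L : LightlikeSubmanifold K.g F M) (Q : STCRStructure K L) :
    Q.IsMinimalD₀ ↔
      ∀ X V : ∀ p : M, TangentSpace 𝓘(ℝ, E) (L.f p),
        IsSectionOf F L.f Q.D₀ X → IsSectionOf F L.f Q.L₁ V →
        ∀ p : M, Q.D₀Component p
          (L.shapeOperator K.nab V (Q.applyJ X) p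
            + K.J (L.f p) (L.shapeOperator K.nab V X p)) = 0 := by
  constructor
  · intro hmin X V hX hV p
    have h : ∀ Z, IsSectionOf F L.f Q.D₀ Z →
        K.g.val (L.f p) (V p) (K.J (L.f p) (Q.dbar Z Z p)) = 0 ∧
        K.g.val (L.f p) (V p) (K.J (L.f p) (K.J (L.f p) (Q.dbar Z Z p))) = 0 := fun Z hZ ↦ by
      have hm := hmin Z hZ p
      rw [Q.inducedDeriv_add_inducedDeriv hZ] at hm
      exact Q.val_L₁_eq_zero_of_tangentialPart_mem hm (hV.2 p)
    rw [Q.D₀Component_eq_zero_iff]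
    intro y hy
    -- The duality formula differentiates `Y`, so the test vector has to be extended to a section.
    obtain ⟨Y, hY, rfl⟩ := Q.D₀_subbundle.exists_isSectionOf L.smooth hy
    rw [Q.val_shapeOperator_add hV hY]
    refine Q.val_dbar_eq_zero (fun Z hZ ↦ ?_) (fun Z hZ ↦ (h Z hZ).1) hX hY
    have := (h Z hZ).2
    rwa [K.J_sq, map_neg, neg_eq_zero] at this
  · intro hA X hX p
    have h : ∀ v ∈ Q.L₁ p, ∀ Y, IsSectionOf F L.f Q.D₀ Y →
        K.g.val (L.f p) v (Q.dbar X Y p) = 0 := fun v hv Y hY ↦ by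
      obtain ⟨V, hV, rfl⟩ := Q.L₁_subbundle.exists_isSectionOf L.smooth hv
      rw [← Q.val_shapeOperator_add hV hY]
      exact Q.D₀Component_eq_zero_iff.1 (hA X V hX hV p) (Y p) (hY.2 p)
    rw [Q.inducedDeriv_add_inducedDeriv hX]
    refine Q.tangentialPart_J_mem_D₀ (Q.dbar_self_mem_tangentAlong hX p) (fun v hv ↦ h v hv X hX)
      fun v hv ↦ ?_
    -- J `dbar X X` = `dbar X (JX)`: this is where the condition is needed for pairs of sections and
    -- not only on the diagonal.
    rw [← Q.dbar_applyJ_right hX]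
    exact h v hv _ (Q.isSectionOf_applyJ hX)
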